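/- Let $(\overline M^{2m+1},\varphi,\xi,\eta,\overline g)$ be a Sasakian space form of constant $\varphi$-sectional curvature $c\in\mathbb R$, that is, a Sasakian manifold (with $\eta=\overline g(\xi,\cdot)$, $\varphi^2=-\mathrm{id}+\eta\otimes\xi$, $d\eta(X,Y)=\overline g(X,\varphi Y)$, $(\overline\nabla_X\varphi)Y=\overline g(X,Y)\xi-\overline g(Y,\xi)X$) whose curvature tensor satisfies $$\begin{aligned}\overline R(X,Y)Z={}&-\tfrac{c-1}{4}\{\eta(Z)[\eta(Y)X-\eta(X)Y]+[\overline g(Y,Z)\eta(X)-\overline g(X,Z)\eta(Y)]\xi\\&+\overline g(\varphi X,Z)\varphi Y+2\overline g(\varphi X,Y)\varphi Z-\overline g(\varphi Y,Z)\varphi X\}+\tfrac{c+3}{4}\{\overline g(Y,Z)X-\overline g(X,Z)Y\}.\end{aligned}$$ Assume that the Ricci tensor $\mathrm{Ric}$ of $\overline g$ is nondegenerate, so that it is a (possibly indefinite) metric on $\overline M$; let $\nabla^\star$ and $R^\star$ be its Levi-Civita connection and curvature. Let $M^{2m}$ be a connected smooth manifold and $\psi:M\to\overline M$ a smooth immersion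 such that $\xi$ is tangent to $M$. Equip $M$ with the metric $g=\psi^*\overline g$, let $N$ be a unit normal ($\overline g(N,N)=1$; it may be chosen separately at each point), $V=-\varphi N$, $A$ the Weingarten operator and $B$ the second fundamental form of $M$ in $(\overline M,\overline g)$, $H=\frac1{2m}\operatorname{trace}_g B$ the mean curvature vector field and $|H|$ its $\overline g$-norm. Call $M$ * *pseudo-Hopf* if $A$ maps $\operatorname{Span}\{\xi,V\}$ into itself at every point; * *Ricci-biharmonic* if $\tau_2^\star(\psi)=-\Delta^\star H-\operatorname{trace}R^\star(d\psi\,\cdot,H)\,d\psi\,\cdot=0$, where $\Delta^\star=-\operatorname{trace}(\nabla^\star)^2$ on sections of $\psi^{-1}T\overline M$, and where the traces (and the Levi-Civita connection of $M$ that enters $(\nabla^\star)^2$) are taken for the metric $\psi^*\mathrm{Ric}$ induced on $M$ by $\mathrm{Ric}$. Suppose that $M$ is a Ricci-biharmonic pseudo-Hopf hypersurface, that $|H|$ is differentiable on $M$, and that $\operatorname{grad}|H|=\beta V$ for some function $\beta:M\to\mathbb R$ (gradient with respect to $g$). Then $\beta=0$ at every point of $M$, and $|H|$ is constant: $M$ has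 constant mean curvature. -/

import Mathlib

open scoped Manifold ContDiff
open Bundle

noncomputable section

namespace RicciBiharmonic

/-! ### Trace of a bilinear map with respect to a nondegenerate symmetric form -/

/-- The trace `∑ g^{ij} B(b_i, b_j)` of a bilinear map `B` with respect to a nondegenerate symmetric
bilinear form `g`: for a basis `b_i` with dual basis `b^i`, the vector `g⁻¹(b^i) = ∑_j g^{ij} b_j`
is the one that represents `b^i` through `g`. For positive definite `g` this is `∑ B(e_i, e_i)`
over any `g`-orthonormal basis. -/
def metricTrace {V W : Type*} [AddCommGroup V] [Module ℝ V] [TopologicalSpace V]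
    [IsTopologicalAddGroup V] [ContinuousSMul ℝ V] [T2Space V] [FiniteDimensional ℝ V]
    [AddCommGroup W] (g : V →L[ℝ] V →L[ℝ] ℝ) (B : V → V → W) : W :=
  ∑ i, B (Module.finBasis ℝ V i)
    (g.inverse (LinearMap.toContinuousLinearMap ((Module.finBasis ℝ V).coord i)))

/-- The pull-back `(v, w) ↦ b(L v, L w)` of a bilinear form under a linear map. -/
def pullForm {V W : Type*} [AddCommGroup V] [Module ℝ V] [TopologicalSpace V]
    [IsTopologicalAddGroup V] [ContinuousSMul ℝ V] [AddCommGroup W] [Module ℝ W]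
    [TopologicalSpace W] [IsTopologicalAddGroup W] [ContinuousSMul ℝ W]
    (b : W →L[ℝ] W →L[ℝ] ℝ) (L : V →L[ℝ] W) : V →L[ℝ] V →L[ℝ] ℝ :=
  (ContinuousLinearMap.precomp ℝ L).comp (b.comp L)

/-! ### Local Riemannian geometry, in an open subset of a Euclidean space

`G` is a field of symmetric nondegenerate bilinear forms, `x` a point, `u v w` vectors. -/

/-- Christoffel symbols of the Levi-Civita connection, by the Koszul formula for constant fields:
`2 G(Γ(u,v), w) = ∂_u G(v,w) + ∂_v G(u,w) - ∂_w G(u,v)`. -/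
def christoffel {n : ℕ}
    (G : EuclideanSpace ℝ (Fin n) →
      EuclideanSpace ℝ (Fin n) →L[ℝ] EuclideanSpace ℝ (Fin n) →L[ℝ] ℝ)
    (x u v : EuclideanSpace ℝ (Fin n)) : EuclideanSpace ℝ (Fin n) :=
  (G x).inverse ((1 / 2 : ℝ) •
    (fderiv ℝ G x u v + fderiv ℝ G x v u - ((fderiv ℝ G x).flip u).flip v))

/-- Curvature `R(u,v)w = ∇_u ∇_v w - ∇_v ∇_u w` for constant fields `u, v, w`. -/
def curvature {n : ℕ}
    (G : EuclideanSpace ℝ (Fin n) →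
      EuclideanSpace ℝ (Fin n) →L[ℝ] EuclideanSpace ℝ (Fin n) →L[ℝ] ℝ)
    (x u v w : EuclideanSpace ℝ (Fin n)) : EuclideanSpace ℝ (Fin n) :=
  fderiv ℝ (fun y ↦ christoffel G y v w) x u - fderiv ℝ (fun y ↦ christoffel G y u w) x v
    + christoffel G x u (christoffel G x v w) - christoffel G x v (christoffel G x u w)

/-- The Ricci tensor `Ric(u,v) = trace (w ↦ R(w,u)v)`, assembled from its components
`Ric(e_i, e_j) = ∑_k (R(e_k,e_i)e_j)_k`. -/
def ricci {n : ℕ}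
    (G : EuclideanSpace ℝ (Fin n) →
      EuclideanSpace ℝ (Fin n) →L[ℝ] EuclideanSpace ℝ (Fin n) →L[ℝ] ℝ)
    (x : EuclideanSpace ℝ (Fin n)) :
    EuclideanSpace ℝ (Fin n) →L[ℝ] EuclideanSpace ℝ (Fin n) →L[ℝ] ℝ :=
  ∑ i, ∑ j, (∑ k, curvature G x (EuclideanSpace.single k 1) (EuclideanSpace.single i 1)
      (EuclideanSpace.single j 1) k) •
    ((EuclideanSpace.proj (𝕜 := ℝ) i).smulRight (EuclideanSpace.proj (𝕜 := ℝ) j) :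
      EuclideanSpace ℝ (Fin n) →L[ℝ] EuclideanSpace ℝ (Fin n) →L[ℝ] ℝ)

/-- The field of forms that `f` induces from `G`: `(f^*G)(u,v) = G(df u, df v)`. -/
def pullbackForm {k n : ℕ}
    (G : EuclideanSpace ℝ (Fin n) →
      EuclideanSpace ℝ (Fin n) →L[ℝ] EuclideanSpace ℝ (Fin n) →L[ℝ] ℝ)
    (f : EuclideanSpace ℝ (Fin k) → EuclideanSpace ℝ (Fin n)) (x : EuclideanSpace ℝ (Fin k)) :
    EuclideanSpace ℝ (Fin k) →L[ℝ] EuclideanSpace ℝ (Fin k) →L[ℝ] ℝ :=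
  pullForm (G (f x)) (fderiv ℝ f x)

/-- The second fundamental form `B = ∇df` of an immersion `f` with the induced metric:
`B(u,v) = ∇_u (df v) - df (∇_u v)`, with the Levi-Civita connections of `G` and of `f^*G`. -/
def localSecondForm {k n : ℕ}
    (G : EuclideanSpace ℝ (Fin n) →
      EuclideanSpace ℝ (Fin n) →L[ℝ] EuclideanSpace ℝ (Fin n) →L[ℝ] ℝ)
    (f : EuclideanSpace ℝ (Fin k) → EuclideanSpace ℝ (Fin n))
    (x u v : EuclideanSpace ℝ (Fin k)) : EuclideanSpace ℝ (Fin n) :=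
  fderiv ℝ (fun y ↦ fderiv ℝ f y v) x u + christoffel G (f x) (fderiv ℝ f x u) (fderiv ℝ f x v)
    - fderiv ℝ f x (christoffel (pullbackForm G f) x u v)

/-- The pull-back along `f` of the Levi-Civita connection of `G`, applied to a field `s`
along `f`, in the direction `u`. -/
def covAlong {k n : ℕ}
    (G : EuclideanSpace ℝ (Fin n) →
      EuclideanSpace ℝ (Fin n) →L[ℝ] EuclideanSpace ℝ (Fin n) →L[ℝ] ℝ)
    (f : EuclideanSpace ℝ (Fin k) → EuclideanSpace ℝ (Fin n))
    (s : EuclideanSpace ℝ (Fin k) → EuclideanSpace ℝ (Fin n))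
    (x u : EuclideanSpace ℝ (Fin k)) : EuclideanSpace ℝ (Fin n) :=
  fderiv ℝ s x u + christoffel G (f x) (fderiv ℝ f x u) (s x)

/-- The Laplacian `Δ s = - trace ∇² s` on fields `s` along `f`, where
`∇²_{u,v} s = ∇_u ∇_v s - ∇_{∇_u v} s` and the trace is taken in the metric `f^*G`. -/
def laplacianAlong {k n : ℕ}
    (G : EuclideanSpace ℝ (Fin n) →
      EuclideanSpace ℝ (Fin n) →L[ℝ] EuclideanSpace ℝ (Fin n) →L[ℝ] ℝ)
    (f : EuclideanSpace ℝ (Fin k) → EuclideanSpace ℝ (Fin n))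
    (s : EuclideanSpace ℝ (Fin k) → EuclideanSpace ℝ (Fin n))
    (x : EuclideanSpace ℝ (Fin k)) : EuclideanSpace ℝ (Fin n) :=
  - metricTrace (pullbackForm G f x) (fun u v ↦
      covAlong G f (fun y ↦ covAlong G f s y v) x u
        - covAlong G f s x (christoffel (pullbackForm G f) x u v))

/-- `- Δ s - trace R(df ·, s) df ·` for a field `s` along `f`, with `Δ`, `R` and the trace formed
with the metric `G` and the metric `f^*G` which it induces. -/
def localBitension {k n : ℕ}
    (G : EuclideanSpace ℝ (Fin n) →
      EuclideanSpace ℝ (Fin n) →L[ℝ] EuclideanSpace ℝ (Fin n) →L[ℝ] ℝ)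
    (f : EuclideanSpace ℝ (Fin k) → EuclideanSpace ℝ (Fin n))
    (s : EuclideanSpace ℝ (Fin k) → EuclideanSpace ℝ (Fin n))
    (x : EuclideanSpace ℝ (Fin k)) : EuclideanSpace ℝ (Fin n) :=
  - laplacianAlong G f s x
    - metricTrace (pullbackForm G f x) (fun u v ↦
        curvature G (f x) (fderiv ℝ f x u) (s x) (fderiv ℝ f x v))

/-! ### Riemannian manifolds and their charts -/

section Charts

variable {n : ℕ} {P : Type*} [TopologicalSpace P] [ChartedSpace (EuclideanSpace ℝ (Fin n)) P]

/-- The components of tangent vectors at `p` in the chart around `q` (`p` in its domain). -/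
def coords (q p : P) : TangentSpace (𝓡 n) p →L[ℝ] EuclideanSpace ℝ (Fin n) :=
  mfderiv (𝓡 n) 𝓘(ℝ, EuclideanSpace ℝ (Fin n)) (extChartAt (𝓡 n) q) p

/-- The tangent vector at `p` with given components in the chart around `q`. -/
def ofCoords (q p : P) : EuclideanSpace ℝ (Fin n) →L[ℝ] TangentSpace (𝓡 n) p :=
  (coords q p).inverse

/-- A Riemannian metric in the chart around `q`. -/
def localMetric [IsManifold (𝓡 n) ∞ P]
    (g : ContMDiffRiemannianMetric (𝓡 n) ∞ (EuclideanSpace ℝ (Fin n))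
      (fun p : P ↦ TangentSpace (𝓡 n) p)) (q : P) (y : EuclideanSpace ℝ (Fin n)) :
    EuclideanSpace ℝ (Fin n) →L[ℝ] EuclideanSpace ℝ (Fin n) →L[ℝ] ℝ :=
  pullForm (g.inner ((extChartAt (𝓡 n) q).symm y))
    (ofCoords q ((extChartAt (𝓡 n) q).symm y))

/-- A field of endomorphisms of the tangent spaces in the chart around `q`. -/
def localEndo (φ : ∀ p : P, TangentSpace (𝓡 n) p →L[ℝ] TangentSpace (𝓡 n) p) (q : P)
    (y : EuclideanSpace ℝ (Fin n)) : EuclideanSpace ℝ (Fin n) →L[ℝ] EuclideanSpace ℝ (Fin n) :=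
  (coords q ((extChartAt (𝓡 n) q).symm y)).comp
    ((φ ((extChartAt (𝓡 n) q).symm y)).comp (ofCoords q ((extChartAt (𝓡 n) q).symm y)))

/-- A vector field in the chart around `q`. -/
def localField (ξ : ∀ p : P, TangentSpace (𝓡 n) p) (q : P) (y : EuclideanSpace ℝ (Fin n)) :
    EuclideanSpace ℝ (Fin n) :=
  coords q ((extChartAt (𝓡 n) q).symm y) (ξ ((extChartAt (𝓡 n) q).symm y))

/-- The Ricci tensor is nondegenerate everywhere, so that it is a (possibly indefinite) metric. -/
def RicciIsMetric [IsManifold (𝓡 n) ∞ P]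
    (g : ContMDiffRiemannianMetric (𝓡 n) ∞ (EuclideanSpace ℝ (Fin n))
      (fun p : P ↦ TangentSpace (𝓡 n) p)) : Prop :=
  ∀ q : P, ∀ y ∈ (extChartAt (𝓡 n) q).target, ∀ u : EuclideanSpace ℝ (Fin n),
    (∀ v, ricci (localMetric g q) y u v = 0) → u = 0

end Charts

/-! ### Sasakian space forms -/

/-- A Sasakian structure `(φ, ξ, η, g)` with `η = g(ξ, ·)` on a manifold of dimension `n`.
The exterior derivative is normalized by `dη(X,Y) = (X η(Y) - Y η(X) - η([X,Y])) / 2`; this and the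
covariant derivative of `φ` are written out in the charts. -/
structure SasakianStructure (n : ℕ) (P : Type*) [TopologicalSpace P]
    [ChartedSpace (EuclideanSpace ℝ (Fin n)) P] [IsManifold (𝓡 n) ∞ P] where
  /-- the Riemannian metric `g` -/
  metric : ContMDiffRiemannianMetric (𝓡 n) ∞ (EuclideanSpace ℝ (Fin n))
    (fun p : P ↦ TangentSpace (𝓡 n) p)
  /-- the endomorphism field `φ` -/
  phi : ∀ p : P, TangentSpace (𝓡 n) p →L[ℝ] TangentSpace (𝓡 n) p
  /-- the structure vector field `ξ` -/
  xi : ∀ p : P, TangentSpace (𝓡 n) p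
  smooth_phi : ContMDiff (𝓡 n)
    ((𝓡 n).prod 𝓘(ℝ, EuclideanSpace ℝ (Fin n) →L[ℝ] EuclideanSpace ℝ (Fin n))) ∞
    (fun p ↦ TotalSpace.mk' (EuclideanSpace ℝ (Fin n) →L[ℝ] EuclideanSpace ℝ (Fin n))
      (E := fun p : P ↦ TangentSpace (𝓡 n) p →L[ℝ] TangentSpace (𝓡 n) p) p (phi p))
  smooth_xi : ContMDiff (𝓡 n) (𝓡 n).tangent ∞
    (fun p ↦ (⟨p, xi p⟩ : TangentBundle (𝓡 n) P))
  phi_phi : ∀ (p : P) (u : TangentSpace (𝓡 n) p),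
    phi p (phi p u) = - u + metric.inner p (xi p) u • xi p
  eta_xi : ∀ p : P, metric.inner p (xi p) (xi p) = 1
  phi_xi : ∀ p : P, phi p (xi p) = 0
  metric_phi : ∀ (p : P) (u v : TangentSpace (𝓡 n) p),
    metric.inner p (phi p u) (phi p v) =
      metric.inner p u v - metric.inner p (xi p) u * metric.inner p (xi p) v
  /-- `dη(X,Y) = g(X, φ Y)` -/
  contact : ∀ q : P, ∀ y ∈ (extChartAt (𝓡 n) q).target, ∀ u v : EuclideanSpace ℝ (Fin n),
    (1 / 2 : ℝ) *
      (fderiv ℝ (fun z ↦ localMetric metric q z (localField xi q z) v) y u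
        - fderiv ℝ (fun z ↦ localMetric metric q z (localField xi q z) u) y v) =
      localMetric metric q y u (localEndo phi q y v)
  /-- `(∇_X φ) Y = g(X,Y) ξ - g(Y,ξ) X` -/
  sasakian : ∀ q : P, ∀ y ∈ (extChartAt (𝓡 n) q).target, ∀ u v : EuclideanSpace ℝ (Fin n),
    fderiv ℝ (fun z ↦ localEndo phi q z v) y u
        + christoffel (localMetric metric q) y u (localEndo phi q y v)
        - localEndo phi q y (christoffel (localMetric metric q) y u v) =
      localMetric metric q y u v • localField xi q y
        - localMetric metric q y v (localField xi q y) • u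

/-- The Sasakian manifold has constant `φ`-sectional curvature `c`: its curvature tensor is
`R(X,Y)Z = -(c-1)/4 {η(Z)[η(Y)X - η(X)Y] + [g(Y,Z)η(X) - g(X,Z)η(Y)]ξ + g(φX,Z)φY + 2g(φX,Y)φZ
- g(φY,Z)φX} + (c+3)/4 {g(Y,Z)X - g(X,Z)Y}`. -/
def SasakianStructure.IsSpaceForm {n : ℕ} {P : Type*} [TopologicalSpace P]
    [ChartedSpace (EuclideanSpace ℝ (Fin n)) P] [IsManifold (𝓡 n) ∞ P]
    (S : SasakianStructure n P) (c : ℝ) : Prop :=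
  ∀ q : P, ∀ y ∈ (extChartAt (𝓡 n) q).target, ∀ X Y Z : EuclideanSpace ℝ (Fin n),
    let g := localMetric S.metric q y
    let φ := localEndo S.phi q y
    let ξ := localField S.xi q y
    curvature (localMetric S.metric q) y X Y Z =
      (-((c - 1) / 4)) • (g ξ Z • (g ξ Y • X - g ξ X • Y)
          + (g Y Z * g ξ X - g X Z * g ξ Y) • ξ
          + g (φ X) Z • φ Y + (2 * g (φ X) Y) • φ Z - g (φ Y) Z • φ X)
        + ((c + 3) / 4) • (g Y Z • X - g X Z • Y)

/-! ### Immersed submanifolds -/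

section Immersions

instance {n : ℕ} {P : Type*} [TopologicalSpace P] [ChartedSpace (EuclideanSpace ℝ (Fin n)) P]
    (p : P) : FiniteDimensional ℝ (TangentSpace (𝓡 n) p) :=
  inferInstanceAs (FiniteDimensional ℝ (EuclideanSpace ℝ (Fin n)))

instance {n : ℕ} {P : Type*} [TopologicalSpace P] [ChartedSpace (EuclideanSpace ℝ (Fin n)) P]
    (p : P) : T2Space (TangentSpace (𝓡 n) p) :=
  inferInstanceAs (T2Space (EuclideanSpace ℝ (Fin n)))

variable {k n : ℕ}
  {M : Type*} [TopologicalSpace M] [ChartedSpace (EuclideanSpace ℝ (Fin k)) M]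
  {P : Type*} [TopologicalSpace P] [ChartedSpace (EuclideanSpace ℝ (Fin n)) P]

/-- A smooth map with injective differential everywhere. -/
def IsSmoothImmersion (ψ : M → P) : Prop :=
  ContMDiff (𝓡 k) (𝓡 n) ∞ ψ ∧
    ∀ p : M, Function.Injective (mfderiv (𝓡 k) (𝓡 n) ψ p)

/-- The map `ψ` in the charts around `p` and `ψ p`. -/
def localMap (ψ : M → P) (p : M) (x : EuclideanSpace ℝ (Fin k)) : EuclideanSpace ℝ (Fin n) :=
  extChartAt (𝓡 n) (ψ p) (ψ ((extChartAt (𝓡 k) p).symm x))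

/-- A vector field along `ψ` in the charts around `p` and `ψ p`. -/
def localAlong (ψ : M → P) (s : ∀ p : M, TangentSpace (𝓡 n) (ψ p)) (p : M)
    (x : EuclideanSpace ℝ (Fin k)) : EuclideanSpace ℝ (Fin n) :=
  coords (ψ p) (ψ ((extChartAt (𝓡 k) p).symm x)) (s ((extChartAt (𝓡 k) p).symm x))

variable [IsManifold (𝓡 n) ∞ P]
  (g : ContMDiffRiemannianMetric (𝓡 n) ∞ (EuclideanSpace ℝ (Fin n))
      (fun p : P ↦ TangentSpace (𝓡 n) p)) (ψ : M → P)

/-- The metric on `M` induced by `g`. -/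
def inducedMetric (p : M) : TangentSpace (𝓡 k) p →L[ℝ] TangentSpace (𝓡 k) p →L[ℝ] ℝ :=
  pullForm (g.inner (ψ p)) (mfderiv (𝓡 k) (𝓡 n) ψ p)

/-- The second fundamental form `B` of `M` in `(P, g)` at `p`. -/
def secondForm (p : M) (u v : TangentSpace (𝓡 k) p) : TangentSpace (𝓡 n) (ψ p) :=
  ofCoords (ψ p) (ψ p) (localSecondForm (localMetric g (ψ p)) (localMap ψ p)
    (extChartAt (𝓡 k) p p) (coords p p u) (coords p p v))

/-- The mean curvature vector field `H = (1 / dim M) trace B` of `M` in `(P, g)`. -/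
def meanCurvatureVector (p : M) : TangentSpace (𝓡 n) (ψ p) :=
  (k : ℝ)⁻¹ • metricTrace (inducedMetric (k := k) g ψ p) (secondForm (k := k) g ψ p)

/-- The mean curvature `|H|`. -/
def meanCurvature (p : M) : ℝ :=
  √(g.inner (ψ p) (meanCurvatureVector (k := k) g ψ p) (meanCurvatureVector (k := k) g ψ p))

/-- The gradient of a function on `M` with respect to the metric induced by `g`. -/
def surfaceGradient (h : M → ℝ) (p : M) : TangentSpace (𝓡 k) p :=
  (inducedMetric g ψ p).inverse
    (mfderiv (𝓡 k) 𝓘(ℝ, ℝ) h p : TangentSpace (𝓡 k) p →L[ℝ] ℝ)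

/-- `N` picks a unit normal vector at each point of `M`. Continuity is not required, so that the
choice exists on every hypersurface, orientable or not. -/
def IsUnitNormal (N : ∀ p : M, TangentSpace (𝓡 n) (ψ p)) : Prop :=
  ∀ p : M, g.inner (ψ p) (N p) (N p) = 1 ∧
    ∀ u : TangentSpace (𝓡 k) p, g.inner (ψ p) (N p) (mfderiv (𝓡 k) (𝓡 n) ψ p u) = 0

/-- The Weingarten operator `A` for the unit normal `N`: the vector `A u` with
`g(A u, v) = g(B(u,v), N)` for all `v`, that is `A u = ∑ g^{ij} g(B(u,b_i),N) b_j`. -/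
def weingarten (N : ∀ p : M, TangentSpace (𝓡 n) (ψ p)) (p : M) (u : TangentSpace (𝓡 k) p) :
    TangentSpace (𝓡 k) p :=
  metricTrace (inducedMetric g ψ p)
    (fun a b ↦ g.inner (ψ p) (secondForm g ψ p u a) (N p) • b)

/-- The bitension field `τ₂* = - Δ* H - trace R*(dψ ·, H) dψ ·`: the connection, the curvature, the
Laplacian and the traces are those of the metric `Ric` on `P` and of the metric it induces on `M`,
and `H` is the mean curvature vector field of `M` in `(P, g)`. -/
def ricciBitension (p : M) : TangentSpace (𝓡 n) (ψ p) :=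
  ofCoords (ψ p) (ψ p) (localBitension (ricci (localMetric g (ψ p))) (localMap (k := k) ψ p)
    (localAlong ψ (meanCurvatureVector (k := k) g ψ) p) (extChartAt (𝓡 k) p p))

/-- `M` is Ricci-biharmonic: its bitension field for the metric `Ric` vanishes. -/
def IsRicciBiharmonic : Prop := ∀ p : M, ricciBitension (k := k) g ψ p = 0

/-- The structure vector field is tangent to `M`. -/
def XiTangent (S : SasakianStructure n P) : Prop :=
  ∀ p : M, ∃ u : TangentSpace (𝓡 k) p, mfderiv (𝓡 k) (𝓡 n) ψ p u = S.xi (ψ p)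

end Immersions

section Hypersurfaces

variable {k n : ℕ}
  {M : Type*} [TopologicalSpace M] [ChartedSpace (EuclideanSpace ℝ (Fin k)) M]
  {P : Type*} [TopologicalSpace P] [ChartedSpace (EuclideanSpace ℝ (Fin n)) P]
  [IsManifold (𝓡 n) ∞ P]

/-- The vector field `V = - φ N`. -/
def fieldV (S : SasakianStructure n P) (ψ : M → P) (N : ∀ p : M, TangentSpace (𝓡 n) (ψ p))
    (p : M) : TangentSpace (𝓡 n) (ψ p) :=
  - S.phi (ψ p) (N p)

/-- Pseudo-Hopf: the Weingarten operator maps `Span {ξ, V}` to itself. -/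
def IsPseudoHopf (S : SasakianStructure n P) (ψ : M → P)
    (N : ∀ p : M, TangentSpace (𝓡 n) (ψ p)) : Prop :=
  ∀ (p : M) (u : TangentSpace (𝓡 k) p),
    mfderiv (𝓡 k) (𝓡 n) ψ p u ∈ Submodule.span ℝ {S.xi (ψ p), fieldV S ψ N p} →
    mfderiv (𝓡 k) (𝓡 n) ψ p (weingarten S.metric ψ N p u) ∈
      Submodule.span ℝ {S.xi (ψ p), fieldV S ψ N p}

end Hypersurfaces

end RicciBiharmonic

end

open RicciBiharmonic

/-!
The Ricci tensor of a Sasakian space form is an `η`-deformation `a g + b η ⊗ η` of the metric. A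
normal field `s` of a submanifold tangent to `ξ` has values in `ker η`, so it is also normal for
`Ric`, and `Ric(s, s) = a g(s, s)`. Differentiating `η(s) = 0` twice along the submanifold and using
`∇ξ = -φ`, the `η`-component of the bitension of `s` becomes, up to a factor, the trace of
`g(df u, φ ∇*_v s)`. On a hypersurface `∇*_v s = r(v) s + df (t v)` with `t` self-adjoint, and the
contribution of `t` is the trace of the skew form `g(df u, φ df v)` against a self-adjoint operator,
hence zero. What is left is `r` in the direction `φ s`, so biharmonicity forces the derivative of
`|s|²` along `φ s` to vanish.

For `s = H` this says `V |H| = 0` wherever `H ≠ 0`. Since `grad |H| = β V`, it follows that `β = 0`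
there, and where `H = 0` the function `|H|` is minimal. So `d|H| = 0` everywhere.
-/

noncomputable section

namespace RicciBiharmonic

open Filter Topology

set_option maxSynthPendingDepth 3

/-! ### Traces with respect to a nondegenerate form -/

section MetricTrace

variable {V W : Type*} [AddCommGroup V] [Module ℝ V] [TopologicalSpace V]
  [IsTopologicalAddGroup V] [ContinuousSMul ℝ V]

theorem pullForm_apply [AddCommGroup W] [Module ℝ W] [TopologicalSpace W]
    [IsTopologicalAddGroup W] [ContinuousSMul ℝ W] (g : W →L[ℝ] W →L[ℝ] ℝ) (L : V →L[ℝ] W)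
    (u v : V) : pullForm g L u v = g (L u) (L v) := rfl

variable [T2Space V] [FiniteDimensional ℝ V] {g : V →L[ℝ] V →L[ℝ] ℝ}

theorem isInvertible_of_nondegenerate (hg : ∀ u, (∀ v, g u v = 0) → u = 0) :
    g.IsInvertible := by
  let e : (V →ₗ[ℝ] ℝ) ≃ₗ[ℝ] (V →L[ℝ] ℝ) := LinearMap.toContinuousLinearMap
  have : FiniteDimensional ℝ (V →L[ℝ] ℝ) := e.finiteDimensional
  have hinj : Function.Injective g.toLinearMap :=
    (injective_iff_map_eq_zero g.toLinearMap).2 fun u hu ↦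
      hg u fun v ↦ DFunLike.congr_fun hu v
  have hdim : Module.finrank ℝ V = Module.finrank ℝ (V →L[ℝ] ℝ) :=
    Subspace.dual_finrank_eq.symm.trans e.finrank_eq
  exact ⟨(LinearEquiv.ofInjectiveOfFinrankEq g.toLinearMap hinj hdim).toContinuousLinearEquiv, rfl⟩

/-- The dual basis `g⁻¹(b^i)` of the basis `b_i` in the definition of `metricTrace`. -/
def dualVector (g : V →L[ℝ] V →L[ℝ] ℝ) (i : Fin (Module.finrank ℝ V)) : V :=
  g.inverse (LinearMap.toContinuousLinearMap ((Module.finBasis ℝ V).coord i))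

theorem apply_dualVector (hg : g.IsInvertible) (i : Fin (Module.finrank ℝ V)) (v : V) :
    g (dualVector g i) v = (Module.finBasis ℝ V).coord i v := by
  rw [dualVector, hg.self_apply_inverse]
  rfl

theorem sum_apply_dualVector_smul (hg : g.IsInvertible) (v : V) :
    ∑ i, g (dualVector g i) v • Module.finBasis ℝ V i = v := by
  simp_rw [apply_dualVector hg]
  exact (Module.finBasis ℝ V).sum_repr v

theorem sum_apply_finBasis_smul_dualVector (hg : g.IsInvertible) (v : V) :
    ∑ i, g v (Module.finBasis ℝ V i) • dualVector g i = v := by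
  apply hg.injective
  ext w
  conv_rhs => rw [← sum_apply_dualVector_smul hg w]
  simp [mul_comm]

section AddCommGroup

variable [AddCommGroup W]

theorem metricTrace_eq_sum_dualVector (g : V →L[ℝ] V →L[ℝ] ℝ) (B : V → V → W) :
    metricTrace g B = ∑ i, B (Module.finBasis ℝ V i) (dualVector g i) := rfl

theorem metricTrace_add (g : V →L[ℝ] V →L[ℝ] ℝ) (B C : V → V → W) :
    metricTrace g (fun u v ↦ B u v + C u v) = metricTrace g B + metricTrace g C := by
  simp [metricTrace_eq_sum_dualVector, Finset.sum_add_distrib]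

theorem metricTrace_neg (g : V →L[ℝ] V →L[ℝ] ℝ) (B : V → V → W) :
    metricTrace g (fun u v ↦ -B u v) = -metricTrace g B := by
  simp [metricTrace_eq_sum_dualVector]

theorem metricTrace_zero (g : V →L[ℝ] V →L[ℝ] ℝ) : metricTrace g (fun _ _ ↦ (0 : W)) = 0 := by
  simp [metricTrace_eq_sum_dualVector]

end AddCommGroup

variable [AddCommGroup W] [Module ℝ W]

theorem map_metricTrace {W' : Type*} [AddCommGroup W'] [Module ℝ W'] (T : W →ₗ[ℝ] W')
    (g : V →L[ℝ] V →L[ℝ] ℝ) (B : V → V → W) :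
    T (metricTrace g B) = metricTrace g (fun u v ↦ T (B u v)) := by
  simp [metricTrace_eq_sum_dualVector]

theorem metricTrace_apply_mul (hg : g.IsInvertible) (hsymm : ∀ u v, g u v = g v u) (w : V)
    (μ : V →ₗ[ℝ] ℝ) : metricTrace g (fun u v ↦ g u w * μ v) = μ w := by
  conv_rhs => rw [← sum_apply_finBasis_smul_dualVector hg w]
  simp [metricTrace_eq_sum_dualVector, hsymm w]

theorem sum_apply_eq_metricTrace {ι : Type*} [Fintype ι] (hg : g.IsInvertible) {B : V → V → W}
    (hB : IsBilinearMap ℝ B) {b c : ι → V} {t : V → V}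
    (hbc : ∀ v, ∑ i, g v (b i) • c i = t v) :
    ∑ i, B (b i) (c i) = metricTrace g (fun u v ↦ B u (t v)) := by
  obtain ⟨B, rfl⟩ : ∃ B' : V →ₗ[ℝ] V →ₗ[ℝ] W, B = fun u v ↦ B' u v := ⟨hB.toLinearMap, rfl⟩
  have expand_left (i) : B (b i) (c i) =
      ∑ k, g (dualVector g k) (b i) • B (Module.finBasis ℝ V k) (c i) := by
    conv_lhs => rw [← sum_apply_dualVector_smul hg (b i)]
    simp only [map_sum, map_smul, LinearMap.sum_apply, LinearMap.smul_apply]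
  simp only [expand_left, metricTrace_eq_sum_dualVector, ← hbc, map_sum, map_smul]
  exact Finset.sum_comm

theorem metricTrace_flip (hg : g.IsInvertible) (hsymm : ∀ u v, g u v = g v u)
    {B : V → V → W} (hB : IsBilinearMap ℝ B) :
    metricTrace g (fun u v ↦ B v u) = metricTrace g B :=
  sum_apply_eq_metricTrace hg hB (t := id) fun v ↦ by
    simp_rw [hsymm v]
    exact sum_apply_dualVector_smul hg v

theorem metricTrace_selfAdjoint_left (hg : g.IsInvertible) {B : V → V → W}
    (hB : IsBilinearMap ℝ B) {t : V → V} (ht : ∀ u v, g (t u) v = g u (t v)) :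
    metricTrace g (fun u v ↦ B (t u) v) = metricTrace g (fun u v ↦ B u (t v)) :=
  sum_apply_eq_metricTrace hg hB fun v ↦ by
    simp_rw [← ht]
    exact sum_apply_finBasis_smul_dualVector hg (t v)

theorem metricTrace_isometry {V' : Type*} [AddCommGroup V'] [Module ℝ V'] [TopologicalSpace V']
    [IsTopologicalAddGroup V'] [ContinuousSMul ℝ V'] [T2Space V'] [FiniteDimensional ℝ V']
    (hg : g.IsInvertible) {g' : V' →L[ℝ] V' →L[ℝ] ℝ} (hg' : g'.IsInvertible) {L : V' →L[ℝ] V}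
    (hL : Function.Surjective L) (hgg' : ∀ u v, g' u v = g (L u) (L v)) {B : V → V → W}
    (hB : IsBilinearMap ℝ B) :
    metricTrace g' (fun u v ↦ B (L u) (L v)) = metricTrace g B :=
  sum_apply_eq_metricTrace hg hB (t := id) fun v ↦ by
    obtain ⟨w, rfl⟩ := hL v
    change ∑ i, g (L w) (L (Module.finBasis ℝ V' i)) • L (dualVector g' i) = L w
    simp_rw [← hgg', ← map_smul, ← map_sum]
    rw [sum_apply_finBasis_smul_dualVector hg']

theorem metricTrace_skew_selfAdjoint (hg : g.IsInvertible) (hsymm : ∀ u v, g u v = g v u)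
    {C : V → V → ℝ} (hC : IsBilinearMap ℝ C) (hskew : ∀ u v, C u v = -C v u) {t : V →ₗ[ℝ] V}
    (ht : ∀ u v, g (t u) v = g u (t v)) : metricTrace g (fun u v ↦ C u (t v)) = 0 := by
  have hCt : IsBilinearMap ℝ (fun u v ↦ C u (t v)) :=
    ⟨by simp [hC.add_left], by simp [hC.smul_left], by simp [hC.add_right],
      by simp [hC.smul_right]⟩
  have hneg := calc
    metricTrace g (fun u v ↦ C u (t v)) = metricTrace g (fun u v ↦ C (t u) v) :=
      (metricTrace_selfAdjoint_left hg hC ht).symm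
    _ = metricTrace g (fun u v ↦ -C v (t u)) := by simp_rw [← hskew]
    _ = -metricTrace g (fun u v ↦ C u (t v)) := by
      rw [metricTrace_neg, metricTrace_flip hg hsymm hCt]
  linarith

end MetricTrace

section SecondDerivative

variable {E F : Type*} [NormedAddCommGroup E] [NormedSpace ℝ E] [NormedAddCommGroup F]
  [NormedSpace ℝ F] {f : E → F} {x : E}

theorem contDiffAt_fderiv_apply (hf : ContDiffAt ℝ ∞ f x) (v : E) :
    ContDiffAt ℝ ∞ (fun y ↦ fderiv ℝ f y v) x :=
  (hf.fderiv_right le_rfl).clm_apply contDiffAt_const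

theorem differentiableAt_fderiv_apply (hf : ContDiffAt ℝ ∞ f x) (v : E) :
    DifferentiableAt ℝ (fun y ↦ fderiv ℝ f y v) x :=
  (contDiffAt_fderiv_apply hf v).differentiableAt (by simp)

theorem fderiv_fderiv_apply (hf : ContDiffAt ℝ ∞ f x) (u v : E) :
    fderiv ℝ (fun y ↦ fderiv ℝ f y v) x u = fderiv ℝ (fderiv ℝ f) x u v := by
  have hdf : DifferentiableAt ℝ (fderiv ℝ f) x :=
    (hf.fderiv_right (m := ∞) le_rfl).differentiableAt (by simp)
  simp [fderiv_clm_apply hdf (differentiableAt_const v)]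

theorem fderiv_fderiv_symm (hf : ContDiffAt ℝ ∞ f x) (u v : E) :
    fderiv ℝ (fun y ↦ fderiv ℝ f y v) x u = fderiv ℝ (fun y ↦ fderiv ℝ f y u) x v := by
  rw [fderiv_fderiv_apply hf, fderiv_fderiv_apply hf]
  exact hf.isSymmSndFDerivAt (by simpa using WithTop.coe_le_coe.2 (le_top (a := (2 : ℕ∞)))) u v

end SecondDerivative

/-- The model space of the charts of an `n`-manifold. -/
abbrev Euc (n : ℕ) := EuclideanSpace ℝ (Fin n)

/-- A field of bilinear forms in a chart. -/
abbrev FormField (n : ℕ) := Euc n → Euc n →L[ℝ] Euc n →L[ℝ] ℝ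

/-- `G` is a smooth pseudo-Riemannian metric on the open set `U`. -/
structure IsMetricOn {n : ℕ} (G : FormField n) (U : Set (Euc n)) : Prop where
  isOpen : IsOpen U
  contDiffOn : ContDiffOn ℝ ∞ G U
  symm : ∀ y ∈ U, ∀ u v, G y u v = G y v u
  isInvertible : ∀ y ∈ U, (G y).IsInvertible

section Congr

variable {k n : ℕ} {G : FormField n} {f f' : Euc k → Euc n} {x : Euc k}

theorem christoffel_congr {G' : FormField n} {y : Euc n} (h : G =ᶠ[𝓝 y] G') :
    christoffel G y = christoffel G' y := by
  ext1 u
  ext1 v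
  rw [christoffel, christoffel, h.fderiv_eq, h.eq_of_nhds]

theorem covAlong_congr {s s' : Euc k → Euc n} (h : s =ᶠ[𝓝 x] s') :
    covAlong G f s x = covAlong G f s' x := by
  ext1 u
  rw [covAlong, covAlong, h.fderiv_eq, h.eq_of_nhds]

theorem pullbackForm_congr (h : f =ᶠ[𝓝 x] f') : pullbackForm G f =ᶠ[𝓝 x] pullbackForm G f' := by
  filter_upwards [h, h.fderiv (𝕜 := ℝ)] with y hy hy'
  rw [pullbackForm, pullbackForm, hy, hy']

theorem localSecondForm_congr (h : f =ᶠ[𝓝 x] f') :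
    localSecondForm G f x = localSecondForm G f' x := by
  have hfderiv : fderiv ℝ f =ᶠ[𝓝 x] fderiv ℝ f' := h.fderiv
  have hpull : pullbackForm G f =ᶠ[𝓝 x] pullbackForm G f' := pullbackForm_congr h
  ext1 u
  ext1 v
  have hfderiv_apply : (fun y ↦ fderiv ℝ f y v) =ᶠ[𝓝 x] fun y ↦ fderiv ℝ f' y v :=
    hfderiv.fun_comp (· v)
  rw [localSecondForm, localSecondForm, h.eq_of_nhds, hfderiv.eq_of_nhds,
    christoffel_congr hpull, hfderiv_apply.fderiv_eq]

end Congr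

theorem isBilinearMap_christoffel {n : ℕ} (G : FormField n) (y : Euc n) :
    IsBilinearMap ℝ (christoffel G y) := by
  constructor
  all_goals
    intros
    simp only [christoffel, ← map_add, ← map_smul]
    congr 1
    ext w
    simp
    ring

namespace IsMetricOn

variable {k n : ℕ} {G : FormField n} {U : Set (Euc n)} (hG : IsMetricOn G U)
include hG

section Point

variable {y : Euc n} (hy : y ∈ U)
include hy

theorem contDiffAt : ContDiffAt ℝ ∞ G y :=
  hG.contDiffOn.contDiffAt (hG.isOpen.mem_nhds hy)

theorem differentiableAt : DifferentiableAt ℝ G y :=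
  (hG.contDiffAt hy).differentiableAt (by simp)

theorem fderiv_apply (u v w : Euc n) :
    fderiv ℝ G y u v w = fderiv ℝ (fun z ↦ G z v w) y u := by
  rw [fderiv_clm_apply ((hG.differentiableAt hy).clm_apply (differentiableAt_const v))
    (differentiableAt_const w),
    fderiv_clm_apply (hG.differentiableAt hy) (differentiableAt_const v)]
  simp

theorem fderiv_symm (u v w : Euc n) : fderiv ℝ G y u v w = fderiv ℝ G y u w v := by
  have hsymm : (fun z ↦ G z v w) =ᶠ[𝓝 y] fun z ↦ G z w v := by
    filter_upwards [hG.isOpen.mem_nhds hy] with z hz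
    exact hG.symm z hz v w
  rw [hG.fderiv_apply hy, hG.fderiv_apply hy, hsymm.fderiv_eq]

theorem apply_christoffel (u v w : Euc n) :
    2 * G y (christoffel G y u v) w =
      fderiv ℝ G y u v w + fderiv ℝ G y v u w - fderiv ℝ G y w u v := by
  rw [christoffel, (hG.isInvertible y hy).self_apply_inverse]
  simp

theorem christoffel_symm (u v : Euc n) : christoffel G y u v = christoffel G y v u := by
  apply (hG.isInvertible y hy).injective
  ext w
  linarith [hG.apply_christoffel hy u v w, hG.apply_christoffel hy v u w, hG.fderiv_symm hy w u v]

theorem fderiv_eq_christoffel (u v w : Euc n) : fderiv ℝ G y u v w =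
    G y (christoffel G y u v) w + G y v (christoffel G y u w) := by
  rw [hG.symm y hy v]
  linarith [hG.apply_christoffel hy u v w, hG.apply_christoffel hy u w v,
    hG.fderiv_symm hy u v w, hG.fderiv_symm hy v u w, hG.fderiv_symm hy w u v]

theorem eq_christoffel_of_compatible {Γ : Euc n → Euc n → Euc n} (hsymm : ∀ u v, Γ u v = Γ v u)
    (hcompat : ∀ u v w, fderiv ℝ G y u v w = G y (Γ u v) w + G y v (Γ u w)) (u v : Euc n) :
    Γ u v = christoffel G y u v := by
  apply (hG.isInvertible y hy).injective
  ext w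
  have hkoszul := hG.apply_christoffel hy u v w
  rw [hcompat, hcompat, hcompat, hsymm v u, hsymm w u, hsymm w v,
    hG.symm y hy _ (Γ v w), hG.symm y hy _ (Γ u w)] at hkoszul
  linarith

end Point

theorem of_eventuallyEq {G' : FormField n} {y : Euc n} (hy : y ∈ U) (h : G' =ᶠ[𝓝 y] G) :
    ∃ U', y ∈ U' ∧ IsMetricOn G' U' := by
  have heq : ∀ z ∈ interior {z | G' z = G z} ∩ U, G' z = G z :=
    fun z hz ↦ interior_subset (s := {z | G' z = G z}) hz.1
  refine ⟨interior {z | G' z = G z} ∩ U, ⟨mem_interior_iff_mem_nhds.2 h, hy⟩,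
    isOpen_interior.inter hG.isOpen,
    (hG.contDiffOn.mono Set.inter_subset_right).congr heq, fun z hz ↦ ?_, fun z hz ↦ ?_⟩
  · rw [heq z hz]
    exact hG.symm z hz.2
  · rw [heq z hz]
    exact hG.isInvertible z hz.2

theorem contDiffAt_christoffel {F : Type*} [NormedAddCommGroup F] [NormedSpace ℝ F]
    {f u v : F → Euc n} {x : F} (hx : f x ∈ U) (hf : ContDiffAt ℝ ∞ f x)
    (hu : ContDiffAt ℝ ∞ u x) (hv : ContDiffAt ℝ ∞ v x) :
    ContDiffAt ℝ ∞ (fun z ↦ christoffel G (f z) (u z) (v z)) x := by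
  have hdG : ContDiffAt ℝ ∞ (fun z ↦ fderiv ℝ G (f z)) x :=
    ((hG.contDiffAt hx).fderiv_right le_rfl).comp x hf
  have hGf : ContDiffAt ℝ ∞ (fun z ↦ G (f z)) x := (hG.contDiffAt hx).comp x hf
  have hinv : ContDiffAt ℝ ∞ (fun z ↦ (G (f z)).inverse) x :=
    ContDiffAt.comp (g := ContinuousLinearMap.inverse) x
      ((hG.isInvertible _ hx).contDiffAt_map_inverse (n := ∞)) hGf
  have hflip : ContDiffAt ℝ ∞ (fun z ↦ ((fderiv ℝ G (f z)).flip (u z)).flip (v z)) x := by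
    have hflip₁ : ContDiffAt ℝ ∞ (fun z ↦ (fderiv ℝ G (f z)).flip (u z)) x :=
      ((ContinuousLinearMap.flipₗᵢ ℝ (Euc n) (Euc n)
        (Euc n →L[ℝ] ℝ)).toContinuousLinearEquiv.contDiff.contDiffAt.comp x hdG).clm_apply hu
    exact ((ContinuousLinearMap.flipₗᵢ ℝ (Euc n) (Euc n)
      ℝ).toContinuousLinearEquiv.contDiff.contDiffAt.comp x hflip₁).clm_apply hv
  exact hinv.clm_apply (((((hdG.clm_apply hu).clm_apply hv).add
    ((hdG.clm_apply hv).clm_apply hu)).sub hflip).const_smul (1 / 2 : ℝ))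

variable {f s t : Euc k → Euc n} {x : Euc k} (hx : f x ∈ U)
include hx

theorem contDiffAt_covAlong (hf : ContDiffAt ℝ ∞ f x) (hs : ContDiffAt ℝ ∞ s x) (v : Euc k) :
    ContDiffAt ℝ ∞ (fun y ↦ covAlong G f s y v) x :=
  (contDiffAt_fderiv_apply hs v).add
    (hG.contDiffAt_christoffel hx hf (contDiffAt_fderiv_apply hf v) hs)

theorem fderiv_apply_along (hf : DifferentiableAt ℝ f x) (hs : DifferentiableAt ℝ s x)
    (ht : DifferentiableAt ℝ t x) (u : Euc k) :
    fderiv ℝ (fun z ↦ G (f z) (s z) (t z)) x u =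
      G (f x) (covAlong G f s x u) (t x) + G (f x) (s x) (covAlong G f t x u) := by
  have hGf := (hG.differentiableAt hx).hasFDerivAt.comp x hf.hasFDerivAt
  have hder := ((hGf.clm_apply hs.hasFDerivAt).clm_apply ht.hasFDerivAt).fderiv
  simp only [Function.comp_apply] at hder
  simp only [hder, covAlong, add_apply, ContinuousLinearMap.comp_apply,
    ContinuousLinearMap.flip_apply, map_add, hG.fderiv_eq_christoffel hx (fderiv ℝ f x u)]
  ring

end IsMetricOn

section CovAlong

variable {k n : ℕ} {G : FormField n} {f s t : Euc k → Euc n} {x : Euc k}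

theorem covAlong_zero : covAlong G f (fun _ ↦ 0) x = 0 := by
  ext1 u
  simpa [covAlong] using (isBilinearMap_christoffel G (f x)).smul_right 0 (fderiv ℝ f x u) 0

theorem covAlong_id_const (G : FormField n) (v y u : Euc n) :
    covAlong G id (fun _ ↦ v) y u = christoffel G y u v := by
  simp [covAlong]

theorem isLinearMap_covAlong (G : FormField n) (f s : Euc k → Euc n) (x : Euc k) :
    IsLinearMap ℝ (covAlong G f s x) := by
  have hΓ := isBilinearMap_christoffel G (f x)
  constructor
  · intro u v
    simp only [covAlong, map_add, hΓ.add_left]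
    abel
  · intro c u
    simp only [covAlong, map_smul, hΓ.smul_left, smul_add]

theorem curvature_eq_covAlong (G : FormField n) (y u v w : Euc n) :
    curvature G y u v w =
      covAlong G id (fun z ↦ covAlong G id (fun _ ↦ w) z v) y u -
        covAlong G id (fun z ↦ covAlong G id (fun _ ↦ w) z u) y v := by
  simp only [covAlong_id_const]
  simp only [curvature, covAlong, fderiv_id, ContinuousLinearMap.id_apply, id]
  abel

end CovAlong

section Immersion

variable {k n : ℕ} {G : FormField n} {U : Set (Euc n)} {f : Euc k → Euc n} {O : Set (Euc k)}
  {x : Euc k}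

theorem covAlong_fderiv (G : FormField n) (f : Euc k → Euc n) (x u v : Euc k) :
    covAlong G f (fun y ↦ fderiv ℝ f y v) x u =
      localSecondForm G f x u v + fderiv ℝ f x (christoffel (pullbackForm G f) x u v) := by
  rw [localSecondForm, covAlong, sub_add_cancel]

theorem IsMetricOn.covAlong_fderiv_symm (hG : IsMetricOn G U) (hfx : f x ∈ U)
    (hf : ContDiffAt ℝ ∞ f x) (u v : Euc k) :
    covAlong G f (fun y ↦ fderiv ℝ f y v) x u = covAlong G f (fun y ↦ fderiv ℝ f y u) x v := by
  rw [covAlong, covAlong, fderiv_fderiv_symm hf, hG.christoffel_symm hfx]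

theorem IsMetricOn.pullbackForm (hG : IsMetricOn G U) (hO : IsOpen O) (hf : ContDiffOn ℝ ∞ f O)
    (hU : Set.MapsTo f O U)
    (hnd : ∀ x ∈ O, ∀ u, (∀ v, G (f x) (fderiv ℝ f x u) (fderiv ℝ f x v) = 0) → u = 0) :
    IsMetricOn (RicciBiharmonic.pullbackForm G f) O where
  isOpen := hO
  contDiffOn := by
    refine contDiffOn_clm_apply.2 fun u ↦ contDiffOn_clm_apply.2 fun v x hx ↦ ?_
    have hfx : ContDiffAt ℝ ∞ f x := hf.contDiffAt (hO.mem_nhds hx)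
    have hGf : ContDiffAt ℝ ∞ (G ∘ f) x := (hG.contDiffAt (hU hx)).comp x hfx
    exact ((hGf.clm_apply (contDiffAt_fderiv_apply hfx u)).clm_apply
      (contDiffAt_fderiv_apply hfx v)).contDiffWithinAt
  symm y hy u v := hG.symm _ (hU hy) _ _
  isInvertible y hy := isInvertible_of_nondegenerate (hnd y hy)

theorem isBilinearMap_localSecondForm (G : FormField n) (hf : ContDiffAt ℝ ∞ f x) :
    IsBilinearMap ℝ (localSecondForm G f x) := by
  have hΓ := isBilinearMap_christoffel G (f x)
  have hΓ' := isBilinearMap_christoffel (pullbackForm G f) x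
  constructor
  all_goals
    intros
    simp only [localSecondForm, fderiv_fderiv_apply hf]
    simp only [map_add, map_smul, add_apply, smul_apply,
      hΓ.add_left, hΓ.smul_left, hΓ.add_right, hΓ.smul_right,
      hΓ'.add_left, hΓ'.smul_left, hΓ'.add_right, hΓ'.smul_right]
    module

theorem apply_localSecondForm (hG : IsMetricOn G U) (hM : IsMetricOn (pullbackForm G f) O)
    (hx : x ∈ O) (hfx : f x ∈ U) (hf : ContDiffAt ℝ ∞ f x) (u v w : Euc k) :
    G (f x) (localSecondForm G f x u v) (fderiv ℝ f x w) = 0 := by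
  have hderiv (u v w : Euc k) : fderiv ℝ (pullbackForm G f) x u v w =
      G (f x) (covAlong G f (fun y ↦ fderiv ℝ f y v) x u) (fderiv ℝ f x w) +
        G (f x) (covAlong G f (fun y ↦ fderiv ℝ f y w) x u) (fderiv ℝ f x v) := by
    rw [hG.symm _ hfx _ (fderiv ℝ f x v), hM.fderiv_apply hx]
    exact hG.fderiv_apply_along hfx (hf.differentiableAt (by simp))
      (differentiableAt_fderiv_apply hf v) (differentiableAt_fderiv_apply hf w) u
  have hkoszul := hM.apply_christoffel hx u v w
  rw [hderiv, hderiv, hderiv, hG.covAlong_fderiv_symm hfx hf v u,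
    hG.covAlong_fderiv_symm hfx hf w u, hG.covAlong_fderiv_symm hfx hf w v, pullbackForm,
    pullForm_apply] at hkoszul
  rw [eq_sub_of_add_eq (covAlong_fderiv G f x u v).symm, map_sub, sub_apply]
  linarith

theorem injective_fderiv_of_isMetricOn_pullbackForm (hM : IsMetricOn (pullbackForm G f) O)
    (hx : x ∈ O) : Function.Injective (fderiv ℝ f x) :=
  (injective_iff_map_eq_zero _).2 fun u hu ↦ (hM.isInvertible x hx).injective <| by
    ext v
    simp [pullbackForm, pullForm_apply, hu]

theorem localSecondForm_eq_zero {κ : Euc n → Euc n} {O : Set (Euc n)} {x : Euc n}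
    (hG : IsMetricOn G U) (hM : IsMetricOn (pullbackForm G κ) O) (hx : x ∈ O) (hκx : κ x ∈ U)
    (hκ : ContDiffAt ℝ ∞ κ x) (u v : Euc n) : localSecondForm G κ x u v = 0 := by
  apply (hG.isInvertible _ hκx).injective
  ext w
  obtain ⟨w, rfl⟩ := LinearMap.injective_iff_surjective.1
    (injective_fderiv_of_isMetricOn_pullbackForm hM hx) w
  rw [map_zero]
  exact apply_localSecondForm hG hM hx hκx hκ u v w

theorem fderiv_comp_eventuallyEq {l : ℕ} {κ : Euc n → Euc l} (hf : ContDiffAt ℝ ∞ f x)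
    (hκ : ContDiffAt ℝ ∞ κ (f x)) :
    ∀ᶠ y in 𝓝 x, fderiv ℝ (κ ∘ f) y = (fderiv ℝ κ (f y)).comp (fderiv ℝ f y) := by
  have hf' : ∀ᶠ y in 𝓝 x, ContDiffAt ℝ 1 f y := (hf.of_le (by simp)).eventually (by simp)
  have hκ' : ∀ᶠ y in 𝓝 (f x), ContDiffAt ℝ 1 κ y := (hκ.of_le (by simp)).eventually (by simp)
  filter_upwards [hf', hf.continuousAt.eventually hκ'] with y hfy hκy
  exact fderiv_comp y (hκy.differentiableAt (by simp)) (hfy.differentiableAt (by simp))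

theorem pullbackForm_comp_eventuallyEq {l : ℕ} {G' : FormField l} {κ : Euc n → Euc l}
    (hκG : pullbackForm G' κ =ᶠ[𝓝 (f x)] G) (hf : ContDiffAt ℝ ∞ f x)
    (hκ : ContDiffAt ℝ ∞ κ (f x)) :
    pullbackForm G' (κ ∘ f) =ᶠ[𝓝 x] pullbackForm G f := by
  filter_upwards [fderiv_comp_eventuallyEq hf hκ, hf.continuousAt.eventually hκG] with y hchain hy
  ext a b
  rw [pullbackForm, pullForm_apply, hchain, pullbackForm, pullForm_apply, ← hy]
  rfl

theorem fderiv_fderiv_comp {l : ℕ} {κ : Euc n → Euc l} (hf : ContDiffAt ℝ ∞ f x)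
    (hκ : ContDiffAt ℝ ∞ κ (f x)) (u v : Euc k) :
    fderiv ℝ (fun y ↦ fderiv ℝ (κ ∘ f) y v) x u =
      fderiv ℝ (fderiv ℝ κ) (f x) (fderiv ℝ f x u) (fderiv ℝ f x v) +
        fderiv ℝ κ (f x) (fderiv ℝ (fun y ↦ fderiv ℝ f y v) x u) := by
  have hchain : (fun y ↦ fderiv ℝ (κ ∘ f) y v) =ᶠ[𝓝 x]
      fun y ↦ fderiv ℝ κ (f y) (fderiv ℝ f y v) := by
    filter_upwards [fderiv_comp_eventuallyEq hf hκ] with y hy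
    rw [hy, ContinuousLinearMap.comp_apply]
  have hdκ : HasFDerivAt (fun y ↦ fderiv ℝ κ (f y)) _ x :=
    ((hκ.fderiv_right (m := ∞) le_rfl).differentiableAt (by simp)).hasFDerivAt.comp x
      (hf.differentiableAt (by simp)).hasFDerivAt
  rw [hchain.fderiv_eq, (hdκ.clm_apply (differentiableAt_fderiv_apply hf v).hasFDerivAt).fderiv]
  simp [add_comm]

theorem localSecondForm_comp {l : ℕ} {G' : FormField l} {κ : Euc n → Euc l}
    (hκG : pullbackForm G' κ =ᶠ[𝓝 (f x)] G) (hf : ContDiffAt ℝ ∞ f x)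
    (hκ : ContDiffAt ℝ ∞ κ (f x)) (u v : Euc k) :
    localSecondForm G' (κ ∘ f) x u v =
      localSecondForm G' κ (f x) (fderiv ℝ f x u) (fderiv ℝ f x v) +
        fderiv ℝ κ (f x) (localSecondForm G f x u v) := by
  simp only [localSecondForm, fderiv_fderiv_comp hf hκ, fderiv_fderiv_apply hκ,
    christoffel_congr hκG, christoffel_congr (pullbackForm_comp_eventuallyEq hκG hf hκ),
    (fderiv_comp_eventuallyEq hf hκ).self_of_nhds, ContinuousLinearMap.comp_apply, map_sub,
    map_add, Function.comp_apply]
  abel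

theorem localSecondForm_coordChange {G' : FormField n} {U' : Set (Euc n)} {f' : Euc k → Euc n}
    {O' : Set (Euc k)} {χ : Euc k → Euc k} {κ : Euc n → Euc n}
    (hG : IsMetricOn G U) (hM : IsMetricOn (pullbackForm G f) O) (hx : x ∈ O)
    (hG' : IsMetricOn G' U') (hM' : IsMetricOn (pullbackForm G' f') O')
    (hfx : f x ∈ U) (hfx' : κ (f x) ∈ U') (hx' : χ x ∈ O')
    (hf : ContDiffAt ℝ ∞ f x) (hf' : ContDiffAt ℝ ∞ f' (χ x)) (hχ : ContDiffAt ℝ ∞ χ x)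
    (hκ : ContDiffAt ℝ ∞ κ (f x)) (hκG : pullbackForm G' κ =ᶠ[𝓝 (f x)] G)
    (hcomm : f' ∘ χ =ᶠ[𝓝 x] κ ∘ f) (u v : Euc k) :
    localSecondForm G' f' (χ x) (fderiv ℝ χ x u) (fderiv ℝ χ x v) =
      fderiv ℝ κ (f x) (localSecondForm G f x u v) := by
  have hχG : pullbackForm (pullbackForm G' f') χ =ᶠ[𝓝 x] pullbackForm G f :=
    ((pullbackForm_comp_eventuallyEq .rfl hχ hf').symm.trans
      (pullbackForm_congr hcomm)).trans (pullbackForm_comp_eventuallyEq hκG hf hκ)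
  obtain ⟨U₁, hU₁, hκM⟩ := hG.of_eventuallyEq hfx hκG
  obtain ⟨O₁, hO₁, hχM⟩ := hM.of_eventuallyEq hx hχG
  calc
    _ = localSecondForm G' (f' ∘ χ) x u v := by
      rw [localSecondForm_comp .rfl hχ hf', localSecondForm_eq_zero hM' hχM hO₁ hx' hχ, map_zero,
        add_zero]
    _ = localSecondForm G' (κ ∘ f) x u v := by rw [localSecondForm_congr hcomm]
    _ = _ := by
      rw [localSecondForm_comp hκG hf hκ, localSecondForm_eq_zero hG' hκM hU₁ hfx' hκ, zero_add]

theorem contDiffOn_metricTrace_localSecondForm (hG : IsMetricOn G U)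
    (hM : IsMetricOn (pullbackForm G f) O) (hf : ContDiffOn ℝ ∞ f O) (hU : Set.MapsTo f O U) :
    ContDiffOn ℝ ∞ (fun x ↦ metricTrace (pullbackForm G f x) (localSecondForm G f x)) O := by
  intro x hx
  refine (ContDiffAt.sum fun i _ ↦ ?_ : ContDiffAt ℝ ∞ _ x).contDiffWithinAt
  set u := Module.finBasis ℝ (Euc k) i
  have hfx : ContDiffAt ℝ ∞ f x := hf.contDiffAt (hM.isOpen.mem_nhds hx)
  have hdual : ContDiffAt ℝ ∞ (fun y ↦ dualVector (pullbackForm G f y) i) x :=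
    (((hM.isInvertible x hx).contDiffAt_map_inverse (n := ∞)).comp x
      (hM.contDiffAt hx)).clm_apply contDiffAt_const
  have hdf : ContDiffAt ℝ ∞ (fderiv ℝ f) x := hfx.fderiv_right le_rfl
  have hddf : ContDiffAt ℝ ∞ (fderiv ℝ (fderiv ℝ f)) x := hdf.fderiv_right le_rfl
  have hsmooth := (((hddf.clm_apply (contDiffAt_const (c := u))).clm_apply hdual).add
    (hG.contDiffAt_christoffel (hU hx) hfx (contDiffAt_fderiv_apply hfx u)
      (hdf.clm_apply hdual))).sub
    (hdf.clm_apply (hM.contDiffAt_christoffel (f := id) hx contDiffAt_id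
      (contDiffAt_const (c := u)) hdual))
  refine hsmooth.congr_of_eventuallyEq ?_
  filter_upwards [hM.isOpen.mem_nhds hx] with y hy
  rw [localSecondForm, fderiv_fderiv_apply (hf.contDiffAt (hM.isOpen.mem_nhds hy))]
  rfl

end Immersion

/-! ### Sasakian structures in a chart -/

/-- A Sasakian structure on the open set `U`. The contact condition `dη(X,Y) = G(X, φ Y)` is not a
field, since it follows from `∇ξ = -φ`, a consequence of the equation `sasakian` for `∇φ`. -/
structure IsSasakianOn {n : ℕ} (G : FormField n) (φ : Euc n → Euc n →L[ℝ] Euc n)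
    (ξ : Euc n → Euc n) (U : Set (Euc n)) : Prop where
  metric : IsMetricOn G U
  pos : ∀ y ∈ U, ∀ u, u ≠ 0 → 0 < G y u u
  smooth_phi : ContDiffOn ℝ ∞ φ U
  smooth_xi : ContDiffOn ℝ ∞ ξ U
  phi_phi : ∀ y ∈ U, ∀ u, φ y (φ y u) = -u + G y (ξ y) u • ξ y
  eta_xi : ∀ y ∈ U, G y (ξ y) (ξ y) = 1
  phi_xi : ∀ y ∈ U, φ y (ξ y) = 0
  metric_phi : ∀ y ∈ U, ∀ u v, G y (φ y u) (φ y v) = G y u v - G y (ξ y) u * G y (ξ y) v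
  sasakian : ∀ y ∈ U, ∀ u v, fderiv ℝ (fun z ↦ φ z v) y u + christoffel G y u (φ y v)
    - φ y (christoffel G y u v) = G y u v • ξ y - G y v (ξ y) • u

namespace IsSasakianOn

variable {k n : ℕ} {G : FormField n} {φ : Euc n → Euc n →L[ℝ] Euc n} {ξ : Euc n → Euc n}
  {U : Set (Euc n)} (hS : IsSasakianOn G φ ξ U)
include hS

section Point

variable {y : Euc n} (hy : y ∈ U)
include hy

theorem symm (u v : Euc n) : G y u v = G y v u := hS.metric.symm y hy u v

theorem differentiableAt_phi : DifferentiableAt ℝ φ y :=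
  (hS.smooth_phi.contDiffAt (hS.metric.isOpen.mem_nhds hy)).differentiableAt (by simp)

theorem contDiffAt_xi : ContDiffAt ℝ ∞ ξ y :=
  hS.smooth_xi.contDiffAt (hS.metric.isOpen.mem_nhds hy)

theorem differentiableAt_xi : DifferentiableAt ℝ ξ y :=
  (hS.contDiffAt_xi hy).differentiableAt (by simp)

theorem xi_ne_zero : ξ y ≠ 0 := by
  intro h
  simpa [h] using hS.eta_xi y hy

theorem eta_phi (u : Euc n) : G y (ξ y) (φ y u) = 0 := by
  have hcube := congrArg (φ y) (hS.phi_phi y hy u)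
  rw [hS.phi_phi y hy (φ y u), map_add, map_neg, map_smul, hS.phi_xi y hy, smul_zero, add_zero,
    add_eq_left] at hcube
  exact (smul_eq_zero.1 hcube).resolve_right (hS.xi_ne_zero hy)

theorem phi_skew (u v : Euc n) : G y (φ y u) v = -G y u (φ y v) := by
  have h := hS.metric_phi y hy u (φ y v)
  rw [hS.phi_phi y hy, hS.eta_phi hy, map_add, map_neg, map_smul, hS.symm hy _ (ξ y),
    hS.eta_phi hy, smul_zero, mul_zero] at h
  linarith

end Point

section Along

variable {f s t : Euc k → Euc n} {x : Euc k} (hx : f x ∈ U) (hf : DifferentiableAt ℝ f x)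
include hx hf

theorem covAlong_phi (ht : DifferentiableAt ℝ t x) (u : Euc k) :
    covAlong G f (fun z ↦ φ (f z) (t z)) x u = φ (f x) (covAlong G f t x u) +
      (G (f x) (fderiv ℝ f x u) (t x) • ξ (f x) - G (f x) (ξ (f x)) (t x) • fderiv ℝ f x u) := by
  have hφ := hS.differentiableAt_phi hx
  have hφf : HasFDerivAt (fun z ↦ φ (f z)) ((fderiv ℝ φ (f x)).comp (fderiv ℝ f x)) x :=
    hφ.hasFDerivAt.comp x hf.hasFDerivAt
  have hsasakian := hS.sasakian _ hx (fderiv ℝ f x u) (t x)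
  rw [fderiv_clm_apply hφ (differentiableAt_const _), hS.symm hx (t x)] at hsasakian
  simp only [fderiv_fun_const, Pi.zero_apply, ContinuousLinearMap.comp_zero, zero_add,
    ContinuousLinearMap.flip_apply] at hsasakian
  rw [covAlong, (hφf.clm_apply ht.hasFDerivAt).fderiv, covAlong, map_add]
  simp only [add_apply, ContinuousLinearMap.comp_apply, ContinuousLinearMap.flip_apply]
  linear_combination (norm := module) hsasakian

theorem covAlong_xi (u : Euc k) :
    covAlong G f (fun z ↦ ξ (f z)) x u = -φ (f x) (fderiv ℝ f x u) := by
  have hξf : DifferentiableAt ℝ (fun z ↦ ξ (f z)) x := (hS.differentiableAt_xi hx).comp x hf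
  have hfU : ∀ᶠ z in 𝓝 x, f z ∈ U := hf.continuousAt (hS.metric.isOpen.mem_nhds hx)
  have hphi : φ (f x) (covAlong G f (fun z ↦ ξ (f z)) x u) =
      fderiv ℝ f x u - G (f x) (ξ (f x)) (fderiv ℝ f x u) • ξ (f x) := by
    have hzero : (fun z ↦ φ (f z) (ξ (f z))) =ᶠ[𝓝 x] fun _ ↦ 0 :=
      hfU.mono fun z hz ↦ hS.phi_xi (f z) hz
    have h := hS.covAlong_phi hx hf hξf u
    rw [covAlong_congr hzero, covAlong_zero, Pi.zero_apply, hS.eta_xi _ hx,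
      hS.symm hx _ (ξ (f x))] at h
    linear_combination (norm := module) -h
  have heta : G (f x) (ξ (f x)) (covAlong G f (fun z ↦ ξ (f z)) x u) = 0 := by
    have hone : (fun z ↦ G (f z) (ξ (f z)) (ξ (f z))) =ᶠ[𝓝 x] fun _ ↦ 1 :=
      hfU.mono fun z hz ↦ hS.eta_xi (f z) hz
    have h := hS.metric.fderiv_apply_along hx hf hξf hξf u
    rw [hone.fderiv_eq, fderiv_fun_const, hS.symm hx _ (ξ (f x))] at h
    simp only [Pi.zero_apply, zero_apply] at h
    linarith
  have hphi_phi := congrArg (φ (f x)) hphi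
  rw [hS.phi_phi _ hx, heta, zero_smul, add_zero, map_sub, map_smul, hS.phi_xi _ hx, smul_zero,
    sub_zero] at hphi_phi
  rw [← hphi_phi, neg_neg]

theorem fderiv_eta_along (hs : DifferentiableAt ℝ s x) (u : Euc k) :
    fderiv ℝ (fun z ↦ G (f z) (ξ (f z)) (s z)) x u =
      G (f x) (ξ (f x)) (covAlong G f s x u) + G (f x) (fderiv ℝ f x u) (φ (f x) (s x)) := by
  have hξf : DifferentiableAt ℝ (fun z ↦ ξ (f z)) x := (hS.differentiableAt_xi hx).comp x hf
  rw [hS.metric.fderiv_apply_along hx hf hξf hs, hS.covAlong_xi hx hf, map_neg, neg_apply,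
    hS.phi_skew hx, neg_neg, add_comm]

theorem fderiv_fundamental_along (hs : DifferentiableAt ℝ s x) (ht : DifferentiableAt ℝ t x)
    (u : Euc k) :
    fderiv ℝ (fun z ↦ G (f z) (s z) (φ (f z) (t z))) x u =
      G (f x) (covAlong G f s x u) (φ (f x) (t x)) +
        G (f x) (s x) (φ (f x) (covAlong G f t x u)) +
        (G (f x) (fderiv ℝ f x u) (t x) * G (f x) (ξ (f x)) (s x) -
          G (f x) (ξ (f x)) (t x) * G (f x) (fderiv ℝ f x u) (s x)) := by
  have hφt : DifferentiableAt ℝ (fun z ↦ φ (f z) (t z)) x :=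
    ((hS.differentiableAt_phi hx).comp x hf).clm_apply ht
  rw [hS.metric.fderiv_apply_along hx hf hs hφt, hS.covAlong_phi hx hf ht, map_add, map_sub,
    map_smul, map_smul, hS.symm hx (s x) (ξ (f x)), hS.symm hx (s x) (fderiv ℝ f x u),
    smul_eq_mul, smul_eq_mul, add_assoc]

end Along

end IsSasakianOn

section Ricci

variable {n : ℕ}

theorem sum_apply_single_mul (L : Euc n →L[ℝ] ℝ) (v : Euc n) :
    ∑ k, L (EuclideanSpace.single k 1) * v k = L v := by
  conv_rhs => rw [← (EuclideanSpace.basisFun (Fin n) ℝ).sum_repr v]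
  simp [mul_comm]

theorem sum_apply_single_eq_zero_of_skew {g : Euc n →L[ℝ] Euc n →L[ℝ] ℝ} (hg : g.IsInvertible)
    (hsymm : ∀ u v, g u v = g v u) {T : Euc n →L[ℝ] Euc n}
    (hT : ∀ u v, g (T u) v = -g u (T v)) : ∑ k, T (EuclideanSpace.single k 1) k = 0 := by
  let dual (k : Fin n) : Euc n := g.inverse (EuclideanSpace.proj k)
  have hdual (k : Fin n) (v : Euc n) : g (dual k) v = v k := by
    simp only [dual, hg.self_apply_inverse]
    rfl
  have hexpand (v : Euc n) : ∑ k, g v (EuclideanSpace.single k 1) • dual k = v := by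
    apply hg.injective
    ext w
    simpa [hdual] using sum_apply_single_mul (g v) w
  have hB : IsBilinearMap ℝ (fun u v ↦ g (T u) v) :=
    ⟨by simp, by simp, by simp, by simp⟩
  calc
    _ = ∑ k, g (T (EuclideanSpace.single k 1)) (dual k) := by simp_rw [hsymm (T _), hdual]
    _ = metricTrace g (fun u v ↦ g (T u) (LinearMap.id (R := ℝ) v)) :=
      sum_apply_eq_metricTrace hg hB hexpand
    _ = 0 := metricTrace_skew_selfAdjoint hg hsymm hB
      (fun u v ↦ by rw [hT, hsymm]) fun _ _ ↦ rfl

theorem ricci_eq_of_contraction {G : FormField n} {y : Euc n} {B : Euc n →L[ℝ] Euc n →L[ℝ] ℝ}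
    (hB : ∀ u v, ∑ k, curvature G y (EuclideanSpace.single k 1) u v k = B u v) :
    ricci G y = B := by
  ext u v
  calc
    ricci G y u v = ∑ i, (∑ j, B (EuclideanSpace.single i 1) (EuclideanSpace.single j 1) * v j)
        * u i := by
      simp [ricci, hB, Finset.mul_sum, mul_assoc, mul_comm]
    _ = B u v := by
      simp_rw [sum_apply_single_mul]
      exact sum_apply_single_mul (B.flip v) u

/-- The curvature tensor of a Sasakian space form of `φ`-sectional curvature `c`, on a single
tangent space; it is the right-hand side in `SasakianStructure.IsSpaceForm`. -/
def spaceFormCurvature (g : Euc n →L[ℝ] Euc n →L[ℝ] ℝ) (φ : Euc n →L[ℝ] Euc n) (ξ : Euc n) (c : ℝ)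
    (X Y Z : Euc n) : Euc n :=
  (-((c - 1) / 4)) • (g ξ Z • (g ξ Y • X - g ξ X • Y)
      + (g Y Z * g ξ X - g X Z * g ξ Y) • ξ
      + g (φ X) Z • φ Y + (2 * g (φ X) Y) • φ Z - g (φ Y) Z • φ X)
    + ((c + 3) / 4) • (g Y Z • X - g X Z • Y)

namespace IsSasakianOn

variable {G : FormField n} {φ : Euc n → Euc n →L[ℝ] Euc n} {ξ : Euc n → Euc n} {U : Set (Euc n)}
  (hS : IsSasakianOn G φ ξ U) {y : Euc n} (hy : y ∈ U)
include hS hy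

theorem sum_spaceFormCurvature_single (c : ℝ) (Y Z : Euc n) :
    ∑ k, spaceFormCurvature (G y) (φ y) (ξ y) c (EuclideanSpace.single k 1) Y Z k =
      ((c - 1) / 2 + (n - 1) * (c + 3) / 4) * G y Y Z +
        (-(n + 1) * (c - 1) / 4) * (G y (ξ y) Y * G y (ξ y) Z) := by
  have component (k : Fin n) :
      spaceFormCurvature (G y) (φ y) (ξ y) c (EuclideanSpace.single k 1) Y Z k =
        (-((c - 1) / 4) * (G y (ξ y) Z * G y (ξ y) Y) + (c + 3) / 4 * G y Y Z)
        + (c - 1) / 4 * G y (ξ y) Z * (G y (ξ y) (EuclideanSpace.single k 1) * Y k)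
        - (c - 1) / 4 * G y Y Z * (G y (ξ y) (EuclideanSpace.single k 1) * ξ y k)
        + (c - 1) / 4 * G y (ξ y) Y * (G y Z (EuclideanSpace.single k 1) * ξ y k)
        + (c - 1) / 4 * (G y (φ y Z) (EuclideanSpace.single k 1) * φ y Y k)
        + (c - 1) / 2 * (G y (φ y Y) (EuclideanSpace.single k 1) * φ y Z k)
        + (c - 1) / 4 * G y (φ y Y) Z * φ y (EuclideanSpace.single k 1) k
        - (c + 3) / 4 * (G y Z (EuclideanSpace.single k 1) * Y k) := by
    simp only [spaceFormCurvature, hS.phi_skew hy (EuclideanSpace.single k 1),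
      hS.symm hy (EuclideanSpace.single k 1)]
    simp only [PiLp.add_apply, PiLp.sub_apply, PiLp.smul_apply, smul_eq_mul,
      PiLp.single_apply, if_true]
    ring
  simp only [component, Finset.sum_add_distrib, Finset.sum_sub_distrib, ← Finset.mul_sum,
    sum_apply_single_mul,
    sum_apply_single_eq_zero_of_skew (hS.metric.isInvertible y hy) (hS.symm hy) (hS.phi_skew hy)]
  rw [hS.symm hy (φ y Z), hS.metric_phi y hy, hS.eta_xi y hy, hS.symm hy Z (ξ y), hS.symm hy Z Y]
  simp only [Finset.sum_const, Finset.card_univ, Fintype.card_fin, nsmul_eq_mul]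
  ring

theorem ricci_eq {c : ℝ}
    (hR : ∀ X Y Z, curvature G y X Y Z = spaceFormCurvature (G y) (φ y) (ξ y) c X Y Z)
    (u v : Euc n) :
    ricci G y u v = ((c - 1) / 2 + (n - 1) * (c + 3) / 4) * G y u v +
      (-(n + 1) * (c - 1) / 4) * (G y (ξ y) u * G y (ξ y) v) := by
  have hricci : ricci G y = ((c - 1) / 2 + (n - 1) * (c + 3) / 4) • G y +
      (-(n + 1) * (c - 1) / 4) • (G y (ξ y)).smulRight (G y (ξ y)) :=
    ricci_eq_of_contraction fun Y Z ↦ by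
      simp [hR, hS.sum_spaceFormCurvature_single hy]
  simp [hricci]

end IsSasakianOn

end Ricci

/-! ### The Levi-Civita connection of an `η`-deformation -/

/-- `Gh` is the `η`-deformation `a G + b η ⊗ η` of `G` on `U`, with `η = G(ξ, ·)`. The Ricci tensor
of a Sasakian space form has this shape; the two conditions on the constants express that it is
nondegenerate. -/
structure IsEtaDeformation {n : ℕ} (G : FormField n) (ξ : Euc n → Euc n) (a b : ℝ)
    (Gh : FormField n) (U : Set (Euc n)) : Prop where
  ne_zero : a ≠ 0
  add_ne_zero : a + b ≠ 0
  apply : ∀ y ∈ U, ∀ u v, Gh y u v = a * G y u v + b * (G y (ξ y) u * G y (ξ y) v)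

namespace IsEtaDeformation

variable {k n : ℕ} {G Gh : FormField n} {φ : Euc n → Euc n →L[ℝ] Euc n} {ξ : Euc n → Euc n}
  {a b : ℝ} {U : Set (Euc n)} (hD : IsEtaDeformation G ξ a b Gh U) (hS : IsSasakianOn G φ ξ U)
include hD hS

theorem apply_xi {y : Euc n} (hy : y ∈ U) (u : Euc n) :
    Gh y u (ξ y) = (a + b) * G y (ξ y) u := by
  rw [hD.apply y hy, hS.eta_xi y hy, hS.symm hy u]
  ring

theorem eq_zero_of_forall_apply {y : Euc n} (hy : y ∈ U) {L : Euc k →L[ℝ] Euc n}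
    (hL : Function.Injective L) {w : Euc k} (hw : L w = ξ y) {u : Euc k}
    (hu : ∀ v, Gh y (L u) (L v) = 0) : u = 0 := by
  have heta : G y (ξ y) (L u) = 0 := by
    have h := hu w
    rw [hw, hD.apply_xi hS hy] at h
    exact (mul_eq_zero.1 h).resolve_left hD.add_ne_zero
  have hnorm : G y (L u) (L u) = 0 := by
    have h := hu u
    rw [hD.apply y hy, heta, mul_zero, mul_zero, add_zero] at h
    exact (mul_eq_zero.1 h).resolve_left hD.ne_zero
  by_contra hne
  exact (hS.pos y hy (L u) ((map_ne_zero_iff L hL).2 hne)).ne' hnorm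

theorem isMetricOn : IsMetricOn Gh U where
  isOpen := hS.metric.isOpen
  contDiffOn := by
    refine contDiffOn_clm_apply.2 fun u ↦ contDiffOn_clm_apply.2 fun v ↦
      ContDiffOn.congr (fun y hy ↦ ?_) fun y hy ↦ hD.apply y hy u v
    have hG := hS.metric.contDiffAt hy
    have hη := hG.clm_apply (hS.contDiffAt_xi hy)
    exact ((contDiffAt_const.mul ((hG.clm_apply contDiffAt_const).clm_apply contDiffAt_const)).add
      (contDiffAt_const.mul ((hη.clm_apply contDiffAt_const).mul
        (hη.clm_apply contDiffAt_const)))).contDiffWithinAt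
  symm y hy u v := by
    rw [hD.apply y hy, hD.apply y hy, hS.symm hy u v, mul_comm (G y (ξ y) u)]
  isInvertible _ hy := isInvertible_of_nondegenerate fun _ hu ↦
    hD.eq_zero_of_forall_apply hS hy (L := .id ℝ _) Function.injective_id rfl hu

theorem isMetricOn_pullbackForm {f : Euc k → Euc n} {O : Set (Euc k)} (hO : IsOpen O)
    (hf : ContDiffOn ℝ ∞ f O) (hU : Set.MapsTo f O U)
    (hinj : ∀ x ∈ O, Function.Injective (fderiv ℝ f x))
    (hξ : ∀ x ∈ O, ∃ w, fderiv ℝ f x w = ξ (f x)) : IsMetricOn (pullbackForm Gh f) O :=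
  (hD.isMetricOn hS).pullbackForm hO hf hU fun x hx _ hu ↦
    (hξ x hx).elim fun _ hw ↦ hD.eq_zero_of_forall_apply hS (hU hx) (hinj x hx) hw hu

theorem fderiv_apply {y : Euc n} (hy : y ∈ U) (u v w : Euc n) :
    fderiv ℝ Gh y u v w =
      a * (G y (christoffel G y u v) w + G y v (christoffel G y u w)) +
        b * ((G y (ξ y) (christoffel G y u v) + G y u (φ y v)) * G y (ξ y) w +
          G y (ξ y) v * (G y (ξ y) (christoffel G y u w) + G y u (φ y w))) := by
  have heq : (fun z ↦ Gh z v w) =ᶠ[𝓝 y]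
      fun z ↦ a * G z v w + b * (G z (ξ z) v * G z (ξ z) w) := by
    filter_upwards [hS.metric.isOpen.mem_nhds hy] with z hz
    exact hD.apply z hz v w
  have hη (v : Euc n) : DifferentiableAt ℝ (fun z ↦ G z (ξ z) v) y :=
    ((hS.metric.differentiableAt hy).clm_apply (hS.differentiableAt_xi hy)).clm_apply
      (differentiableAt_const v)
  have hderivη (v : Euc n) : fderiv ℝ (fun z ↦ G z (ξ z) v) y u =
      G y (ξ y) (christoffel G y u v) + G y u (φ y v) := by
    simpa [covAlong_id_const] using
      hS.fderiv_eta_along (f := id) hy differentiableAt_id (differentiableAt_const v) u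
  have hGvw : DifferentiableAt ℝ (fun z ↦ G z v w) y :=
    ((hS.metric.differentiableAt hy).clm_apply (differentiableAt_const v)).clm_apply
      (differentiableAt_const w)
  rw [(hD.isMetricOn hS).fderiv_apply hy, heq.fderiv_eq,
    fderiv_fun_add (hGvw.const_mul a) (((hη v).fun_mul (hη w)).const_mul b),
    fderiv_const_mul hGvw, fderiv_const_mul ((hη v).fun_mul (hη w)), fderiv_fun_mul (hη v) (hη w)]
  simp only [add_apply, smul_apply, smul_eq_mul, hderivη, ← hS.metric.fderiv_apply hy,
    hS.metric.fderiv_eq_christoffel hy]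
  ring

theorem christoffel_eq {y : Euc n} (hy : y ∈ U) (u v : Euc n) :
    christoffel Gh y u v =
      christoffel G y u v - (b / a) • (G y (ξ y) u • φ y v + G y (ξ y) v • φ y u) := by
  refine ((hD.isMetricOn hS).eq_christoffel_of_compatible hy (Γ := fun u v ↦
    christoffel G y u v - (b / a) • (G y (ξ y) u • φ y v + G y (ξ y) v • φ y u)) (fun u v ↦ ?_)
    (fun u v w ↦ ?_) u v).symm
  · rw [hS.metric.christoffel_symm hy, add_comm (G y (ξ y) u • φ y v)]
  · have hne := hD.ne_zero
    have hskew : G y v (φ y u) = -G y u (φ y v) := by rw [hS.symm hy, hS.phi_skew hy]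
    rw [hD.fderiv_apply hS hy, hD.apply y hy, hD.apply y hy]
    simp only [map_sub, map_add, map_smul, sub_apply, add_apply, smul_apply, smul_eq_mul,
      hS.eta_phi hy, hS.phi_skew hy, hskew]
    field_simp
    ring

section Along

variable {f s t : Euc k → Euc n} {x : Euc k} (hx : f x ∈ U)
include hx

theorem covAlong_eq (u : Euc k) :
    covAlong Gh f s x u = covAlong G f s x u - (b / a) • (G (f x) (ξ (f x)) (fderiv ℝ f x u) •
      φ (f x) (s x) + G (f x) (ξ (f x)) (s x) • φ (f x) (fderiv ℝ f x u)) := by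
  rw [covAlong, hD.christoffel_eq hS hx, covAlong, add_sub_assoc]

theorem fderiv_eta_along (hf : DifferentiableAt ℝ f x) (hs : DifferentiableAt ℝ s x) (u : Euc k) :
    fderiv ℝ (fun z ↦ G (f z) (ξ (f z)) (s z)) x u =
      G (f x) (ξ (f x)) (covAlong Gh f s x u) + G (f x) (fderiv ℝ f x u) (φ (f x) (s x)) := by
  rw [hS.fderiv_eta_along hx hf hs, hD.covAlong_eq hS hx]
  simp only [map_add, map_sub, map_smul, hS.eta_phi hx, smul_zero, add_zero, sub_zero]

theorem fderiv_fundamental_along (hf : DifferentiableAt ℝ f x) (hs : DifferentiableAt ℝ s x)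
    (ht : DifferentiableAt ℝ t x) (u : Euc k) :
    fderiv ℝ (fun z ↦ G (f z) (s z) (φ (f z) (t z))) x u =
      G (f x) (covAlong Gh f s x u) (φ (f x) (t x)) +
        G (f x) (s x) (φ (f x) (covAlong Gh f t x u)) +
        (1 + b / a) * (G (f x) (fderiv ℝ f x u) (t x) * G (f x) (ξ (f x)) (s x) -
          G (f x) (ξ (f x)) (t x) * G (f x) (fderiv ℝ f x u) (s x)) := by
  have hphi_phi (v w : Euc n) : G (f x) v (φ (f x) (φ (f x) w)) =
      -(G (f x) v w - G (f x) (ξ (f x)) v * G (f x) (ξ (f x)) w) := by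
    rw [← hS.metric_phi _ hx, hS.phi_skew hx, neg_neg]
  rw [hS.fderiv_fundamental_along hx hf hs ht, hD.covAlong_eq hS hx, hD.covAlong_eq hS hx]
  simp only [map_sub, map_add, map_smul, sub_apply, add_apply, smul_apply, smul_eq_mul,
    hS.metric_phi _ hx, hphi_phi, hS.symm hx (s x) (fderiv ℝ f x u)]
  ring

theorem fderiv_fderiv_eta_along (hf : ContDiffAt ℝ ∞ f x) (hs : ContDiffAt ℝ ∞ s x)
    (u v : Euc k) :
    fderiv ℝ (fun y ↦ fderiv ℝ (fun z ↦ G (f z) (ξ (f z)) (s z)) y v) x u =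
      G (f x) (ξ (f x)) (covAlong Gh f (fun y ↦ covAlong Gh f s y v) x u) +
        G (f x) (fderiv ℝ f x u) (φ (f x) (covAlong Gh f s x v)) +
        (G (f x) (covAlong Gh f (fun y ↦ fderiv ℝ f y v) x u) (φ (f x) (s x)) +
          G (f x) (fderiv ℝ f x v) (φ (f x) (covAlong Gh f s x u)) +
          (1 + b / a) * (G (f x) (fderiv ℝ f x u) (s x) * G (f x) (ξ (f x)) (fderiv ℝ f x v) -
            G (f x) (ξ (f x)) (s x) * G (f x) (fderiv ℝ f x u) (fderiv ℝ f x v))) := by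
  have hfx : DifferentiableAt ℝ f x := hf.differentiableAt (by simp)
  have hsx : DifferentiableAt ℝ s x := hs.differentiableAt (by simp)
  have hdfv := differentiableAt_fderiv_apply hf v
  have hcov : DifferentiableAt ℝ (fun y ↦ covAlong Gh f s y v) x :=
    ((hD.isMetricOn hS).contDiffAt_covAlong hx hf hs v).differentiableAt (by simp)
  have hderiv : (fun y ↦ fderiv ℝ (fun z ↦ G (f z) (ξ (f z)) (s z)) y v) =ᶠ[𝓝 x] fun y ↦
      G (f y) (ξ (f y)) (covAlong Gh f s y v) + G (f y) (fderiv ℝ f y v) (φ (f y) (s y)) := by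
    filter_upwards [hfx.continuousAt (hS.metric.isOpen.mem_nhds hx),
      (hf.of_le (m := 1) (by simp)).eventually (by simp),
      (hs.of_le (m := 1) (by simp)).eventually (by simp)] with y hy hfy hsy
    exact hD.fderiv_eta_along hS hy (hfy.differentiableAt (by simp))
      (hsy.differentiableAt (by simp)) v
  have hG : DifferentiableAt ℝ (fun y ↦ G (f y)) x := (hS.metric.differentiableAt hx).comp x hfx
  have hξ : DifferentiableAt ℝ (fun y ↦ ξ (f y)) x := (hS.differentiableAt_xi hx).comp x hfx
  have hφ : DifferentiableAt ℝ (fun y ↦ φ (f y)) x := (hS.differentiableAt_phi hx).comp x hfx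
  rw [hderiv.fderiv_eq, fderiv_fun_add ((hG.clm_apply hξ).clm_apply hcov)
      ((hG.clm_apply hdfv).clm_apply (hφ.clm_apply hsx)), add_apply,
    hD.fderiv_eta_along hS hx hfx hcov, hD.fderiv_fundamental_along hS hx hfx hdfv hsx]

end Along

theorem eta_curvature {y : Euc n} (hy : y ∈ U) (X Y Z : Euc n) :
    G y (ξ y) (curvature Gh y X Y Z) =
      (1 + b / a) * (G y Y Z * G y (ξ y) X - G y X Z * G y (ξ y) Y) := by
  have hη : ContDiffAt ℝ ∞ (fun z ↦ G z (ξ z) Z) y :=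
    ((hS.metric.contDiffAt hy).clm_apply (hS.contDiffAt_xi hy)).clm_apply contDiffAt_const
  have hsecond (X Y : Euc n) := hD.fderiv_fderiv_eta_along hS (f := id) hy contDiffAt_id
    (contDiffAt_const (c := Z)) X Y
  have hschwarz := fderiv_fderiv_symm hη X Y
  simp only [id] at hsecond
  rw [hsecond, hsecond, (hD.isMetricOn hS).covAlong_fderiv_symm (f := id) hy contDiffAt_id X Y]
    at hschwarz
  simp only [fderiv_id, ContinuousLinearMap.id_apply, hS.symm hy Y X] at hschwarz
  rw [curvature_eq_covAlong, map_sub]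
  linear_combination hschwarz

end IsEtaDeformation

/-! ### Normal fields in the contact distribution -/

theorem range_eq_ker_of_finrank_add_one_eq {V W : Type*} [AddCommGroup V] [Module ℝ V]
    [AddCommGroup W] [Module ℝ W] [FiniteDimensional ℝ W]
    (hdim : Module.finrank ℝ V + 1 = Module.finrank ℝ W) {L : V →ₗ[ℝ] W}
    (hL : Function.Injective L) {l : W →ₗ[ℝ] ℝ} (hl : l ≠ 0) (hlL : ∀ u, l (L u) = 0) :
    LinearMap.range L = LinearMap.ker l := by
  have hle : LinearMap.range L ≤ LinearMap.ker l := by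
    rintro _ ⟨u, rfl⟩
    exact hlL u
  have hker := l.finrank_range_add_finrank_ker
  rw [LinearMap.range_eq_top.2 (LinearMap.surjective hl), finrank_top, Module.finrank_self] at hker
  exact Submodule.eq_of_le_of_finrank_eq hle (by rw [LinearMap.finrank_range_of_inj hL]; omega)

section Weingarten

variable {k n : ℕ} {G : FormField n} {U : Set (Euc n)} (hG : IsMetricOn G U) {f s : Euc k → Euc n}
  {O : Set (Euc k)} {x : Euc k}

theorem exists_fderiv_eq_of_apply_normal_eq_zero (hk : k + 1 = n)
    (hinj : Function.Injective (fderiv ℝ f x))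
    (hs : G (f x) (s x) (s x) ≠ 0) (hsn : ∀ u, G (f x) (s x) (fderiv ℝ f x u) = 0) {v : Euc n}
    (hv : G (f x) (s x) v = 0) : ∃ u, fderiv ℝ f x u = v := by
  have hl : (G (f x) (s x)).toLinearMap ≠ 0 := fun h ↦ hs (LinearMap.congr_fun h (s x))
  have hrange := range_eq_ker_of_finrank_add_one_eq (L := (fderiv ℝ f x).toLinearMap)
    (by simpa using hk) hinj hl hsn
  exact hrange.ge (LinearMap.mem_ker.2 hv)

theorem exists_weingarten (hk : k + 1 = n) (hinj : Function.Injective (fderiv ℝ f x))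
    (hs : G (f x) (s x) (s x) ≠ 0) (hsn : ∀ u, G (f x) (s x) (fderiv ℝ f x u) = 0) :
    ∃ (r : Euc k →ₗ[ℝ] ℝ) (t : Euc k →ₗ[ℝ] Euc k),
      ∀ v, covAlong G f s x v = r v • s x + fderiv ℝ f x (t v) := by
  let D : Euc k →ₗ[ℝ] Euc n := (isLinearMap_covAlong G f s x).mk' _
  let r : Euc k →ₗ[ℝ] ℝ := (G (f x) (s x) (s x))⁻¹ • (G (f x) (s x)).toLinearMap ∘ₗ D
  have hr (v : Euc k) : r v * G (f x) (s x) (s x) = G (f x) (s x) (D v) := by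
    simp [r, mul_right_comm, hs]
  have htangent (v : Euc k) :
      (D - r.smulRight (s x)) v ∈ LinearMap.range (fderiv ℝ f x).toLinearMap :=
    exists_fderiv_eq_of_apply_normal_eq_zero hk hinj hs hsn (by simp [hr])
  let e := LinearEquiv.ofInjective (fderiv ℝ f x).toLinearMap hinj
  refine ⟨r, e.symm.toLinearMap ∘ₗ (D - r.smulRight (s x)).codRestrict _ htangent, fun v ↦ ?_⟩
  have ht := congrArg Subtype.val
    (e.apply_symm_apply ((D - r.smulRight (s x)).codRestrict _ htangent v))
  change fderiv ℝ f x _ = D v - r v • s x at ht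
  change D v = r v • s x + fderiv ℝ f x _
  rw [← sub_eq_iff_eq_add', ← ht]
  rfl

include hG

theorem weingarten_selfAdjoint (hM : IsMetricOn (pullbackForm G f) O) (hx : x ∈ O)
    (hfx : f x ∈ U) (hf : ContDiffAt ℝ ∞ f x) (hs : DifferentiableAt ℝ s x)
    (hsn : ∀ y ∈ O, ∀ u, G (f y) (s y) (fderiv ℝ f y u) = 0) {r : Euc k → ℝ} {t : Euc k → Euc k}
    (hrt : ∀ v, covAlong G f s x v = r v • s x + fderiv ℝ f x (t v)) (u v : Euc k) :
    pullbackForm G f x (t u) v = pullbackForm G f x u (t v) := by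
  have hshape (u v : Euc k) : pullbackForm G f x (t u) v =
      -G (f x) (s x) (covAlong G f (fun y ↦ fderiv ℝ f y v) x u) := by
    have hzero : (fun y ↦ G (f y) (s y) (fderiv ℝ f y v)) =ᶠ[𝓝 x] fun _ ↦ 0 := by
      filter_upwards [hM.isOpen.mem_nhds hx] with y hy
      exact hsn y hy v
    have hderiv := hG.fderiv_apply_along hfx (hf.differentiableAt (by simp)) hs
      (differentiableAt_fderiv_apply hf v) u
    rw [hzero.fderiv_eq, hrt, map_add, map_smul, add_apply, smul_apply, hsn x hx] at hderiv
    simp only [fderiv_fun_const, Pi.zero_apply, zero_apply, smul_zero, zero_add] at hderiv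
    exact eq_neg_of_add_eq_zero_left hderiv.symm
  rw [hM.symm x hx u, hshape, hshape, hG.covAlong_fderiv_symm hfx hf]

theorem fderiv_normal_apply_normal (hfx : f x ∈ U) (hf : DifferentiableAt ℝ f x)
    (hs : DifferentiableAt ℝ s x) (hsn : ∀ u, G (f x) (s x) (fderiv ℝ f x u) = 0)
    {r : ℝ} {u v : Euc k} (hrt : covAlong G f s x v = r • s x + fderiv ℝ f x u) :
    fderiv ℝ (fun y ↦ G (f y) (s y) (s y)) x v = 2 * r * G (f x) (s x) (s x) := by
  rw [hG.fderiv_apply_along hfx hf hs hs, hG.symm _ hfx _ (s x), hrt, map_add, map_smul, hsn,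
    smul_eq_mul]
  ring

end Weingarten

/-- `s` is a smooth normal field along the map `f : O → U` and takes values in the contact
distribution `ker η`. For an immersion tangent to `ξ` every normal field is of this kind. -/
structure IsContactNormalField {k n : ℕ} (G : FormField n) (ξ : Euc n → Euc n) (U : Set (Euc n))
    (f s : Euc k → Euc n) (O : Set (Euc k)) : Prop where
  isOpen : IsOpen O
  mapsTo : Set.MapsTo f O U
  contDiffOn_map : ContDiffOn ℝ ∞ f O
  contDiffOn : ContDiffOn ℝ ∞ s O
  normal : ∀ x ∈ O, ∀ u, G (f x) (s x) (fderiv ℝ f x u) = 0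
  eta : ∀ x ∈ O, G (f x) (ξ (f x)) (s x) = 0

namespace IsContactNormalField

variable {k n : ℕ} {G Gh : FormField n} {φ : Euc n → Euc n →L[ℝ] Euc n} {ξ : Euc n → Euc n}
  {a b : ℝ} {U : Set (Euc n)} {f s : Euc k → Euc n} {O : Set (Euc k)} {x : Euc k}
  (hN : IsContactNormalField G ξ U f s O) (hx : x ∈ O)
include hN hx

theorem contDiffAt_map : ContDiffAt ℝ ∞ f x :=
  hN.contDiffOn_map.contDiffAt (hN.isOpen.mem_nhds hx)

theorem contDiffAt : ContDiffAt ℝ ∞ s x :=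
  hN.contDiffOn.contDiffAt (hN.isOpen.mem_nhds hx)

theorem differentiableAt_map : DifferentiableAt ℝ f x :=
  (hN.contDiffAt_map hx).differentiableAt (by simp)

theorem differentiableAt : DifferentiableAt ℝ s x :=
  (hN.contDiffAt hx).differentiableAt (by simp)

variable (hS : IsSasakianOn G φ ξ U) (hD : IsEtaDeformation G ξ a b Gh U)

include hD

theorem deformation_apply (v : Euc n) : Gh (f x) (s x) v = a * G (f x) (s x) v := by
  rw [hD.apply _ (hN.mapsTo hx), hN.eta x hx, zero_mul, mul_zero, add_zero]

theorem deformation_normal (u : Euc k) : Gh (f x) (s x) (fderiv ℝ f x u) = 0 := by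
  rw [hN.deformation_apply hx hD, hN.normal x hx, mul_zero]

include hS

theorem eta_covAlong (v : Euc k) : G (f x) (ξ (f x)) (covAlong Gh f s x v) =
    -G (f x) (fderiv ℝ f x v) (φ (f x) (s x)) := by
  have hzero : (fun y ↦ G (f y) (ξ (f y)) (s y)) =ᶠ[𝓝 x] fun _ ↦ 0 := by
    filter_upwards [hN.isOpen.mem_nhds hx] with y hy
    exact hN.eta y hy
  have hderiv := hD.fderiv_eta_along hS (hN.mapsTo hx) (hN.differentiableAt_map hx)
    (hN.differentiableAt hx) v
  rw [hzero.fderiv_eq, fderiv_fun_const] at hderiv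
  exact eq_neg_of_add_eq_zero_left hderiv.symm

variable (hM : IsMetricOn (pullbackForm Gh f) O)

include hM

theorem eta_secondDerivative {w : Euc k} (hw : fderiv ℝ f x w = φ (f x) (s x)) (u v : Euc k) :
    G (f x) (ξ (f x)) (covAlong Gh f (fun y ↦ covAlong Gh f s y v) x u -
      covAlong Gh f s x (christoffel (pullbackForm Gh f) x u v)) =
    -(G (f x) (fderiv ℝ f x v) (φ (f x) (covAlong Gh f s x u)) +
      G (f x) (fderiv ℝ f x u) (φ (f x) (covAlong Gh f s x v))) := by
  have hfx := hN.mapsTo hx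
  have hzero : (fun y ↦ fderiv ℝ (fun z ↦ G (f z) (ξ (f z)) (s z)) y v) =ᶠ[𝓝 x] fun _ ↦ 0 := by
    have hη : (fun y ↦ G (f y) (ξ (f y)) (s y)) =ᶠ[𝓝 x] fun _ ↦ 0 := by
      filter_upwards [hN.isOpen.mem_nhds hx] with y hy
      exact hN.eta y hy
    filter_upwards [hη.fderiv (𝕜 := ℝ)] with y hy
    rw [hy, fderiv_fun_const]
    rfl
  have hnormal_part : G (f x) (localSecondForm Gh f x u v) (φ (f x) (s x)) = 0 := by
    have h := apply_localSecondForm (hD.isMetricOn hS) hM hx hfx (hN.contDiffAt_map hx) u v w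
    rw [hw, hD.apply _ hfx, hS.eta_phi hfx, mul_zero, mul_zero, add_zero] at h
    exact (mul_eq_zero.1 h).resolve_left hD.ne_zero
  have hderiv := hD.fderiv_fderiv_eta_along hS hfx (hN.contDiffAt_map hx) (hN.contDiffAt hx) u v
  rw [hzero.fderiv_eq, fderiv_fun_const, covAlong_fderiv, map_add, add_apply, hnormal_part,
    zero_add, hN.eta x hx, hS.symm hfx _ (s x), hN.normal x hx, zero_mul, zero_mul, sub_zero,
    mul_zero, add_zero] at hderiv
  rw [map_sub, hN.eta_covAlong hx hS hD]
  simp only [Pi.zero_apply, zero_apply] at hderiv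
  linarith

theorem metricTrace_fundamental_covAlong {w : Euc k} (hw : fderiv ℝ f x w = φ (f x) (s x))
    (hbi : localBitension Gh f s x = 0) :
    metricTrace (pullbackForm Gh f x)
      (fun u v ↦ G (f x) (fderiv ℝ f x u) (φ (f x) (covAlong Gh f s x v))) = 0 := by
  set T : Euc k → Euc k → ℝ :=
    fun u v ↦ G (f x) (fderiv ℝ f x u) (φ (f x) (covAlong Gh f s x v)) with hT
  have hT_bilinear : IsBilinearMap ℝ T := by
    have hcov := isLinearMap_covAlong Gh f s x
    constructor <;> intros <;> simp [hT, hcov.map_add, hcov.map_smul]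
  have hcurv (u v : Euc k) : G (f x) (ξ (f x))
      (curvature Gh (f x) (fderiv ℝ f x u) (s x) (fderiv ℝ f x v)) = 0 := by
    rw [hD.eta_curvature hS (hN.mapsTo hx), hN.eta x hx, hN.normal x hx, zero_mul, mul_zero,
      sub_zero, mul_zero]
  have hη : (G (f x) (ξ (f x))).toLinearMap (localBitension Gh f s x) = 0 := by
    rw [hbi, map_zero]
  rw [localBitension, laplacianAlong, neg_neg, map_sub, map_metricTrace, map_metricTrace] at hη
  simp only [ContinuousLinearMap.coe_coe, hcurv, hN.eta_secondDerivative hx hS hD hM hw,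
    metricTrace_zero, sub_zero, metricTrace_neg, metricTrace_add] at hη
  have hflip := metricTrace_flip (hM.isInvertible x hx) (hM.symm x hx) hT_bilinear
  simp only [hT] at hflip ⊢
  linarith

theorem weingarten_apply_eq_zero {w : Euc k} (hw : fderiv ℝ f x w = φ (f x) (s x))
    (hbi : localBitension Gh f s x = 0) {r : Euc k →ₗ[ℝ] ℝ} {t : Euc k →ₗ[ℝ] Euc k}
    (hrt : ∀ v, covAlong Gh f s x v = r v • s x + fderiv ℝ f x (t v)) : r w = 0 := by
  have hfx := hN.mapsTo hx
  have hself := weingarten_selfAdjoint (hD.isMetricOn hS) hM hx hfx (hN.contDiffAt_map hx)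
    (hN.differentiableAt hx) (fun y hy ↦ hN.deformation_normal hy hD) hrt
  have hw_dual (u : Euc k) :
      G (f x) (fderiv ℝ f x u) (φ (f x) (s x)) = a⁻¹ * pullbackForm Gh f x u w := by
    rw [pullbackForm, pullForm_apply, hw, hD.apply _ hfx, hS.eta_phi hfx, mul_zero, mul_zero,
      add_zero, inv_mul_cancel_left₀ hD.ne_zero]
  have hskew : metricTrace (pullbackForm Gh f x)
      (fun u v ↦ G (f x) (fderiv ℝ f x u) (φ (f x) (fderiv ℝ f x (t v)))) = 0 :=
    metricTrace_skew_selfAdjoint (hM.isInvertible x hx) (hM.symm x hx)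
      (C := fun u v ↦ G (f x) (fderiv ℝ f x u) (φ (f x) (fderiv ℝ f x v)))
      ⟨by simp, by simp, by simp, by simp⟩
      (fun u v ↦ by rw [← hS.phi_skew hfx, hS.symm hfx]) hself
  have htrace := hN.metricTrace_fundamental_covAlong hx hS hD hM hw hbi
  have hsplit (u v : Euc k) : G (f x) (fderiv ℝ f x u) (φ (f x) (covAlong Gh f s x v)) =
      pullbackForm Gh f x u w * (a⁻¹ • r) v +
        G (f x) (fderiv ℝ f x u) (φ (f x) (fderiv ℝ f x (t v))) := by
    rw [hrt, map_add, map_add, map_smul, map_smul, hw_dual, LinearMap.smul_apply, smul_eq_mul,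
      smul_eq_mul]
    ring
  simp only [hsplit] at htrace
  rw [metricTrace_add, hskew, add_zero,
    metricTrace_apply_mul (hM.isInvertible x hx) (hM.symm x hx)] at htrace
  exact (mul_eq_zero.1 htrace).resolve_left (inv_ne_zero hD.ne_zero)

theorem exists_fderiv_normSq_eq_zero (hk : k + 1 = n) (hsx : s x ≠ 0)
    (hbi : localBitension Gh f s x = 0) :
    ∃ w, fderiv ℝ f x w = φ (f x) (s x) ∧ fderiv ℝ (fun y ↦ G (f y) (s y) (s y)) x w = 0 := by
  have hfx := hN.mapsTo hx
  have hnorm : G (f x) (s x) (s x) ≠ 0 := (hS.pos _ hfx _ hsx).ne'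
  have hnorm' : Gh (f x) (s x) (s x) ≠ 0 := by
    rw [hN.deformation_apply hx hD]
    exact mul_ne_zero hD.ne_zero hnorm
  have hinj := injective_fderiv_of_isMetricOn_pullbackForm hM hx
  obtain ⟨w, hw⟩ := exists_fderiv_eq_of_apply_normal_eq_zero hk hinj hnorm (hN.normal x hx)
    (v := φ (f x) (s x)) (by
      linarith [hS.phi_skew hfx (s x) (s x), hS.symm hfx (s x) (φ (f x) (s x))])
  obtain ⟨r, t, hrt⟩ :=
    exists_weingarten (G := Gh) hk hinj hnorm' (hN.deformation_normal hx hD)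
  have hderiv := fderiv_normal_apply_normal (hD.isMetricOn hS) hfx (hN.differentiableAt_map hx)
    (hN.differentiableAt hx) (hN.deformation_normal hx hD) (hrt w)
  have hscale : (fun y ↦ Gh (f y) (s y) (s y)) =ᶠ[𝓝 x] fun y ↦ a * G (f y) (s y) (s y) := by
    filter_upwards [hN.isOpen.mem_nhds hx] with y hy
    exact hN.deformation_apply hy hD (s y)
  have hdiff : DifferentiableAt ℝ (fun y ↦ G (f y) (s y) (s y)) x :=
    (((hS.metric.differentiableAt hfx).comp x (hN.differentiableAt_map hx)).clm_apply
      (hN.differentiableAt hx)).clm_apply (hN.differentiableAt hx)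
  rw [hN.weingarten_apply_eq_zero hx hS hD hM hw hbi hrt, mul_zero, zero_mul, hscale.fderiv_eq,
    fderiv_const_mul hdiff, smul_apply, smul_eq_mul] at hderiv
  exact ⟨w, hw, (mul_eq_zero.1 hderiv).resolve_left hD.ne_zero⟩

end IsContactNormalField

/-! ### Expressions in charts -/

section Charts

variable {n : ℕ} {P : Type*} [TopologicalSpace P] [ChartedSpace (Euc n) P]

theorem localField_extChartAt {q p : P} (hp : p ∈ (extChartAt (𝓡 n) q).source)
    (ξ : ∀ p : P, TangentSpace (𝓡 n) p) :
    localField ξ q (extChartAt (𝓡 n) q p) = coords q p (ξ p) := by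
  obtain ⟨y, hy, rfl⟩ := (extChartAt (𝓡 n) q).symm_image_target_eq_source.ge hp
  rw [(extChartAt (𝓡 n) q).right_inv hy, localField]

variable [IsManifold (𝓡 n) ∞ P]

section Point

variable {q p : P} (hp : p ∈ (extChartAt (𝓡 n) q).source)
include hp

theorem isInvertible_coords : (coords (n := n) q p).IsInvertible :=
  isInvertible_mfderiv_extChartAt hp

theorem coords_ofCoords (u : Euc n) : coords q p (ofCoords q p u) = u :=
  (isInvertible_coords hp).self_apply_inverse u

theorem ofCoords_coords (u : TangentSpace (𝓡 n) p) : ofCoords q p (coords q p u) = u :=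
  (isInvertible_coords hp).inverse_apply_self u

theorem ofCoords_ne_zero {u : Euc n} (hu : u ≠ 0) : ofCoords q p u ≠ 0 := fun h ↦ hu <| by
  rw [← coords_ofCoords hp u, h, map_zero]

theorem coords_eq_trivializationAt (u : TangentSpace (𝓡 n) p) :
    coords q p u = (trivializationAt (Euc n) (TangentSpace (𝓡 n)) q ⟨p, u⟩).2 := by
  have hchart : p ∈ (chartAt (Euc n) q).source := by rwa [extChartAt_source] at hp
  have hbase : p ∈ (trivializationAt (Euc n) (TangentSpace (𝓡 n) : P → Type _) q).baseSet := by
    rwa [TangentBundle.trivializationAt_baseSet]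
  rw [coords, ← TangentBundle.continuousLinearMapAt_trivializationAt hchart]
  exact Trivialization.continuousLinearMapAt_apply_of_mem (R := ℝ) _ hbase u

theorem hasMFDerivAt_extChartAt_coords :
    HasMFDerivAt (𝓡 n) 𝓘(ℝ, Euc n) (extChartAt (𝓡 n) q) p (coords q p) :=
  (mdifferentiableAt_extChartAt (by rwa [extChartAt_source] at hp)).hasMFDerivAt

theorem contMDiffAt_extChartAt_symm : ContMDiffAt 𝓘(ℝ, Euc n) (𝓡 n) ∞
    (extChartAt (𝓡 n) q).symm (extChartAt (𝓡 n) q p) :=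
  (contMDiffOn_extChartAt_symm q).contMDiffAt
    ((isOpen_extChartAt_target q).mem_nhds ((extChartAt (𝓡 n) q).map_source hp))

theorem fderiv_apply_coords {F : Type*} [NormedAddCommGroup F] [NormedSpace ℝ F] {h : Euc n → F}
    (hh : DifferentiableAt ℝ h (extChartAt (𝓡 n) q p)) {h' : P → F}
    (hh' : h ∘ extChartAt (𝓡 n) q =ᶠ[𝓝 p] h') (u : TangentSpace (𝓡 n) p) :
    fderiv ℝ h (extChartAt (𝓡 n) q p) (coords q p u) = mfderiv (𝓡 n) 𝓘(ℝ, F) h' p u := by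
  have hcomp := (hh.hasFDerivAt.hasMFDerivAt.comp p
    (hasMFDerivAt_extChartAt_coords hp)).congr_of_eventuallyEq hh'.symm
  rw [hcomp.mfderiv]
  rfl

theorem localEndo_coords (φ : ∀ p : P, TangentSpace (𝓡 n) p →L[ℝ] TangentSpace (𝓡 n) p)
    (u : TangentSpace (𝓡 n) p) :
    localEndo φ q (extChartAt (𝓡 n) q p) (coords q p u) = coords q p (φ p u) := by
  obtain ⟨y, hy, rfl⟩ := (extChartAt (𝓡 n) q).symm_image_target_eq_source.ge hp
  rw [(extChartAt (𝓡 n) q).right_inv hy]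
  simp only [localEndo, ContinuousLinearMap.comp_apply, ofCoords_coords hp]

end Point

theorem contMDiffOn_section_iff_coords {q : P} {σ : ∀ p : P, TangentSpace (𝓡 n) p} :
    ContMDiffOn (𝓡 n) ((𝓡 n).prod 𝓘(ℝ, Euc n)) ∞ (fun p ↦ TotalSpace.mk' (Euc n) p (σ p))
      (extChartAt (𝓡 n) q).source ↔
    ContMDiffOn (𝓡 n) 𝓘(ℝ, Euc n) ∞ (fun p ↦ coords q p (σ p)) (extChartAt (𝓡 n) q).source := by
  rw [Trivialization.contMDiffOn_section_iff (trivializationAt (Euc n) (TangentSpace (𝓡 n)) q)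
    (isOpen_extChartAt_source q)]
  · exact contMDiffOn_congr fun p hp ↦ (coords_eq_trivializationAt hp (σ p)).symm
  · rw [TangentBundle.trivializationAt_baseSet, extChartAt_source]

theorem contMDiffOn_ofCoords (q : P) (u : Euc n) :
    ContMDiffOn (𝓡 n) ((𝓡 n).prod 𝓘(ℝ, Euc n)) ∞
      (fun p ↦ TotalSpace.mk' (Euc n) p (ofCoords q p u)) (extChartAt (𝓡 n) q).source := by
  rw [contMDiffOn_section_iff_coords]
  exact (contMDiffOn_const (c := u)).congr fun p hp ↦ coords_ofCoords hp u

theorem contDiffOn_comp_extChartAt_symm {F : Type*} [NormedAddCommGroup F] [NormedSpace ℝ F]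
    {q : P} {h : P → F} (hh : ContMDiffOn (𝓡 n) 𝓘(ℝ, F) ∞ h (extChartAt (𝓡 n) q).source) :
    ContDiffOn ℝ ∞ (h ∘ (extChartAt (𝓡 n) q).symm) (extChartAt (𝓡 n) q).target := by
  rw [← contMDiffOn_iff_contDiffOn]
  exact hh.comp (contMDiffOn_extChartAt_symm q) (extChartAt (𝓡 n) q).mapsTo_symm

theorem contDiffOn_localField {q : P} {σ : ∀ p : P, TangentSpace (𝓡 n) p}
    (hσ : ContMDiffOn (𝓡 n) ((𝓡 n).prod 𝓘(ℝ, Euc n)) ∞ (fun p ↦ TotalSpace.mk' (Euc n) p (σ p))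
      (extChartAt (𝓡 n) q).source) :
    ContDiffOn ℝ ∞ (localField σ q) (extChartAt (𝓡 n) q).target :=
  contDiffOn_comp_extChartAt_symm (contMDiffOn_section_iff_coords.1 hσ)

theorem contDiffOn_localEndo {φ : ∀ p : P, TangentSpace (𝓡 n) p →L[ℝ] TangentSpace (𝓡 n) p}
    (hφ : ContMDiff (𝓡 n) ((𝓡 n).prod 𝓘(ℝ, Euc n →L[ℝ] Euc n)) ∞
      (fun p ↦ TotalSpace.mk' (Euc n →L[ℝ] Euc n)
        (E := fun p : P ↦ TangentSpace (𝓡 n) p →L[ℝ] TangentSpace (𝓡 n) p) p (φ p))) (q : P) :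
    ContDiffOn ℝ ∞ (localEndo φ q) (extChartAt (𝓡 n) q).target :=
  contDiffOn_clm_apply.2 fun u ↦
    contDiffOn_localField (hφ.contMDiffOn.clm_bundle_apply (contMDiffOn_ofCoords q u))

section Metric

variable (g : ContMDiffRiemannianMetric (𝓡 n) ∞ (Euc n) (fun p : P ↦ TangentSpace (𝓡 n) p))

theorem contDiffOn_localMetric (q : P) :
    ContDiffOn ℝ ∞ (localMetric g q) (extChartAt (𝓡 n) q).target := by
  refine contDiffOn_clm_apply.2 fun u ↦ contDiffOn_clm_apply.2 fun v ↦
    contDiffOn_comp_extChartAt_symm (h := fun p ↦ g.inner p (ofCoords q p u) (ofCoords q p v))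
      fun p hp ↦ ?_
  have hsection := ContMDiffOn.clm_bundle_apply₂ (F₁ := Euc n) (F₂ := Euc n)
    (F₃ := ℝ) (E₃ := Bundle.Trivial P ℝ) g.contMDiff.contMDiffOn (contMDiffOn_ofCoords q u)
    (contMDiffOn_ofCoords q v) p hp
  exact (contMDiffWithinAt_totalSpace.1 hsection).2

theorem localMetric_apply (q : P) (y u v : Euc n) :
    localMetric g q y u v = g.inner ((extChartAt (𝓡 n) q).symm y)
      (ofCoords q _ u) (ofCoords q _ v) := rfl

theorem localMetric_coords {q p : P} (hp : p ∈ (extChartAt (𝓡 n) q).source)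
    (u v : TangentSpace (𝓡 n) p) :
    localMetric g q (extChartAt (𝓡 n) q p) (coords q p u) (coords q p v) = g.inner p u v := by
  obtain ⟨y, hy, rfl⟩ := (extChartAt (𝓡 n) q).symm_image_target_eq_source.ge hp
  rw [(extChartAt (𝓡 n) q).right_inv hy, localMetric_apply, ofCoords_coords hp, ofCoords_coords hp]

theorem localMetric_pos {q : P} {y : Euc n} (hy : y ∈ (extChartAt (𝓡 n) q).target) {u : Euc n}
    (hu : u ≠ 0) : 0 < localMetric g q y u u :=
  g.pos _ _ (ofCoords_ne_zero ((extChartAt (𝓡 n) q).map_target hy) hu)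

theorem isMetricOn_localMetric (q : P) :
    IsMetricOn (localMetric g q) (extChartAt (𝓡 n) q).target where
  isOpen := isOpen_extChartAt_target q
  contDiffOn := contDiffOn_localMetric g q
  symm _ _ _ _ := g.symm _ _ _
  isInvertible y hy := isInvertible_of_nondegenerate fun u hu ↦ by
    by_contra hne
    exact (localMetric_pos g hy hne).ne' (hu u)

end Metric

namespace SasakianStructure

variable (S : SasakianStructure n P) (q : P)

theorem isSasakianOn : IsSasakianOn (localMetric S.metric q) (localEndo S.phi q)
    (localField S.xi q) (extChartAt (𝓡 n) q).target := by
  have ofCoords_xi {y : Euc n} (hy : y ∈ (extChartAt (𝓡 n) q).target) :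
      ofCoords q ((extChartAt (𝓡 n) q).symm y) (localField S.xi q y) = S.xi _ :=
    ofCoords_coords ((extChartAt (𝓡 n) q).map_target hy) _
  have phi_apply (y u : Euc n) :
      localEndo S.phi q y u = coords q _ (S.phi _ (ofCoords q _ u)) := rfl
  have ofCoords_phi {y : Euc n} (hy : y ∈ (extChartAt (𝓡 n) q).target) (u : Euc n) :
      ofCoords q ((extChartAt (𝓡 n) q).symm y) (localEndo S.phi q y u) =
        S.phi _ (ofCoords q _ u) :=
    ofCoords_coords ((extChartAt (𝓡 n) q).map_target hy) _
  exact {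
    metric := isMetricOn_localMetric S.metric q
    pos := fun _ hy _ hu ↦ localMetric_pos S.metric hy hu
    smooth_phi := contDiffOn_localEndo S.smooth_phi q
    smooth_xi := contDiffOn_localField S.smooth_xi.contMDiffOn
    phi_phi := fun y hy u ↦ by
      rw [phi_apply, ofCoords_phi hy, S.phi_phi, map_add, map_neg, map_smul,
        coords_ofCoords ((extChartAt (𝓡 n) q).map_target hy), localMetric_apply, ofCoords_xi hy]
      rfl
    eta_xi := fun y hy ↦ by rw [localMetric_apply, ofCoords_xi hy, S.eta_xi]
    phi_xi := fun y hy ↦ by rw [phi_apply, ofCoords_xi hy, S.phi_xi, map_zero]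
    metric_phi := fun y hy u v ↦ by
      simp only [localMetric_apply, ofCoords_phi hy, ofCoords_xi hy, S.metric_phi]
    sasakian := S.sasakian q }

end SasakianStructure

section Transition

variable {q q' p : P} (hp : p ∈ (extChartAt (𝓡 n) q).source)
  (hp' : p ∈ (extChartAt (𝓡 n) q').source)
include hp hp'

theorem eventually_extChartAt_symm_mem_source :
    ∀ᶠ y in 𝓝 (extChartAt (𝓡 n) q p), (extChartAt (𝓡 n) q).symm y ∈
      (extChartAt (𝓡 n) q').source := by
  refine (contMDiffAt_extChartAt_symm hp).continuousAt.eventually_mem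
    ((isOpen_extChartAt_source q').mem_nhds ?_)
  rwa [(extChartAt (𝓡 n) q).left_inv hp]

theorem contDiffAt_transition :
    ContDiffAt ℝ ∞ (extChartAt (𝓡 n) q' ∘ (extChartAt (𝓡 n) q).symm) (extChartAt (𝓡 n) q p) := by
  rw [← contMDiffAt_iff_contDiffAt]
  refine ContMDiffAt.comp _ ?_ (contMDiffAt_extChartAt_symm hp)
  rw [(extChartAt (𝓡 n) q).left_inv hp]
  exact contMDiffAt_extChartAt' (by rwa [extChartAt_source] at hp')

theorem fderiv_transition (u : TangentSpace (𝓡 n) p) :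
    fderiv ℝ (extChartAt (𝓡 n) q' ∘ (extChartAt (𝓡 n) q).symm) (extChartAt (𝓡 n) q p)
      (coords q p u) = coords q' p u := by
  refine fderiv_apply_coords hp ((contDiffAt_transition hp hp').differentiableAt (by simp)) ?_ u
  filter_upwards [(isOpen_extChartAt_source q).mem_nhds hp] with z hz
  simp only [Function.comp_apply, (extChartAt (𝓡 n) q).left_inv hz]

theorem pullbackForm_transition
    (g : ContMDiffRiemannianMetric (𝓡 n) ∞ (Euc n) (fun p : P ↦ TangentSpace (𝓡 n) p)) :
    pullbackForm (localMetric g q') (extChartAt (𝓡 n) q' ∘ (extChartAt (𝓡 n) q).symm)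
      =ᶠ[𝓝 (extChartAt (𝓡 n) q p)] localMetric g q := by
  filter_upwards [eventually_extChartAt_symm_mem_source hp hp',
    (isOpen_extChartAt_target q).mem_nhds ((extChartAt (𝓡 n) q).map_source hp)] with y hyq' hy
  have hyq := (extChartAt (𝓡 n) q).map_target hy
  ext u v
  obtain ⟨u, rfl⟩ := (isInvertible_coords hyq).surjective u
  obtain ⟨v, rfl⟩ := (isInvertible_coords hyq).surjective v
  have hderiv := fderiv_transition hyq hyq'
  have hmetric := localMetric_coords g hyq
  rw [(extChartAt (𝓡 n) q).right_inv hy] at hderiv hmetric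
  rw [hmetric, pullbackForm, pullForm_apply, hderiv, hderiv]
  exact localMetric_coords g hyq' u v

end Transition

end Charts

section Maps

variable {k n : ℕ} {M : Type*} [TopologicalSpace M] [ChartedSpace (Euc k) M]
  {P : Type*} [TopologicalSpace P] [ChartedSpace (Euc n) P]

/-- The domain of the expression `localMap ψ p₀` of `ψ` in the charts around `p₀` and `ψ p₀`. -/
def localDomain (k n : ℕ) {M : Type*} [TopologicalSpace M] [ChartedSpace (Euc k) M]
    {P : Type*} [TopologicalSpace P] [ChartedSpace (Euc n) P] (ψ : M → P) (p₀ : M) :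
    Set (Euc k) :=
  (extChartAt (𝓡 k) p₀).target ∩
    (extChartAt (𝓡 k) p₀).symm ⁻¹' (ψ ⁻¹' (extChartAt (𝓡 n) (ψ p₀)).source)

section Domain

variable {ψ : M → P} {p₀ : M}

theorem exists_of_mem_localDomain {x : Euc k} (hx : x ∈ localDomain k n ψ p₀) :
    ∃ p ∈ (extChartAt (𝓡 k) p₀).source,
      ψ p ∈ (extChartAt (𝓡 n) (ψ p₀)).source ∧ extChartAt (𝓡 k) p₀ p = x :=
  ⟨(extChartAt (𝓡 k) p₀).symm x, (extChartAt (𝓡 k) p₀).map_target hx.1, hx.2,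
    (extChartAt (𝓡 k) p₀).right_inv hx.1⟩

theorem isOpen_localDomain (hψ : Continuous ψ) (p₀ : M) : IsOpen (localDomain k n ψ p₀) :=
  (continuousOn_extChartAt_symm p₀).isOpen_inter_preimage (isOpen_extChartAt_target p₀)
    ((isOpen_extChartAt_source (ψ p₀)).preimage hψ)

theorem mapsTo_localMap (ψ : M → P) (p₀ : M) :
    Set.MapsTo (localMap (k := k) (n := n) ψ p₀) (localDomain k n ψ p₀)
      (extChartAt (𝓡 n) (ψ p₀)).target :=
  fun _ hx ↦ (extChartAt (𝓡 n) (ψ p₀)).map_source hx.2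

variable {p : M} (hp : p ∈ (extChartAt (𝓡 k) p₀).source)
include hp

theorem localMap_extChartAt : localMap (k := k) (n := n) ψ p₀ (extChartAt (𝓡 k) p₀ p) =
    extChartAt (𝓡 n) (ψ p₀) (ψ p) := by
  rw [localMap, (extChartAt (𝓡 k) p₀).left_inv hp]

theorem localAlong_extChartAt (s : ∀ p : M, TangentSpace (𝓡 n) (ψ p)) :
    localAlong ψ s p₀ (extChartAt (𝓡 k) p₀ p) = coords (ψ p₀) (ψ p) (s p) := by
  obtain ⟨y, hy, rfl⟩ := (extChartAt (𝓡 k) p₀).symm_image_target_eq_source.ge hp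
  rw [(extChartAt (𝓡 k) p₀).right_inv hy, localAlong]

theorem extChartAt_mem_localDomain (hψp : ψ p ∈ (extChartAt (𝓡 n) (ψ p₀)).source) :
    extChartAt (𝓡 k) p₀ p ∈ localDomain k n ψ p₀ := by
  refine ⟨(extChartAt (𝓡 k) p₀).map_source hp, ?_⟩
  simpa only [Set.mem_preimage, (extChartAt (𝓡 k) p₀).left_inv hp] using hψp

theorem localMap_comp_transition [IsManifold (𝓡 k) ∞ M] (hψ : Continuous ψ)
    (hψp : ψ p ∈ (extChartAt (𝓡 n) (ψ p₀)).source) {p₁ : M}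
    (hp₁ : p ∈ (extChartAt (𝓡 k) p₁).source) :
    localMap (k := k) (n := n) ψ p₁ ∘ (extChartAt (𝓡 k) p₁ ∘ (extChartAt (𝓡 k) p₀).symm)
      =ᶠ[𝓝 (extChartAt (𝓡 k) p₀ p)]
    (extChartAt (𝓡 n) (ψ p₁) ∘ (extChartAt (𝓡 n) (ψ p₀)).symm) ∘ localMap ψ p₀ := by
  filter_upwards [eventually_extChartAt_symm_mem_source hp hp₁,
    (isOpen_localDomain hψ p₀).mem_nhds (extChartAt_mem_localDomain hp hψp)] with z hz hz'
  simp only [Function.comp_apply, localMap, (extChartAt (𝓡 k) p₁).left_inv hz,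
    (extChartAt (𝓡 n) (ψ p₀)).left_inv hz'.2]

end Domain

namespace IsSmoothImmersion

variable [IsManifold (𝓡 n) ∞ P] {ψ : M → P} (hψ : IsSmoothImmersion (k := k) (n := n) ψ)
include hψ

theorem isInvertible_inducedMetric
    (g : ContMDiffRiemannianMetric (𝓡 n) ∞ (Euc n) (fun p : P ↦ TangentSpace (𝓡 n) p)) (p : M) :
    (inducedMetric (k := k) g ψ p).IsInvertible :=
  isInvertible_of_nondegenerate fun u hu ↦ by
    by_contra hne
    exact (g.pos _ _ ((map_ne_zero_iff _ (hψ.2 p)).2 hne)).ne' (hu u)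

variable [IsManifold (𝓡 k) ∞ M]

theorem contDiffOn_localMap (p₀ : M) :
    ContDiffOn ℝ ∞ (localMap (k := k) (n := n) ψ p₀) (localDomain k n ψ p₀) := by
  rw [← contMDiffOn_iff_contDiffOn]
  have hchart : ContMDiffOn (𝓡 n) 𝓘(ℝ, Euc n) ∞ (extChartAt (𝓡 n) (ψ p₀))
      (extChartAt (𝓡 n) (ψ p₀)).source := by
    rw [extChartAt_source]
    exact contMDiffOn_extChartAt
  exact hchart.comp (hψ.1.comp_contMDiffOn
    ((contMDiffOn_extChartAt_symm p₀).mono Set.inter_subset_left)) fun _ hx ↦ hx.2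

theorem contDiffAt_localMap {p₀ : M} {x : Euc k} (hx : x ∈ localDomain k n ψ p₀) :
    ContDiffAt ℝ ∞ (localMap (k := k) (n := n) ψ p₀) x :=
  (hψ.contDiffOn_localMap p₀).contDiffAt
    ((isOpen_localDomain hψ.1.continuous p₀).mem_nhds hx)

section Point

variable {p₀ p : M} (hp : p ∈ (extChartAt (𝓡 k) p₀).source)
  (hψp : ψ p ∈ (extChartAt (𝓡 n) (ψ p₀)).source)
include hp hψp

theorem fderiv_localMap (u : TangentSpace (𝓡 k) p) :
    fderiv ℝ (localMap (k := k) (n := n) ψ p₀) (extChartAt (𝓡 k) p₀ p) (coords p₀ p u) =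
      coords (ψ p₀) (ψ p) (mfderiv (𝓡 k) (𝓡 n) ψ p u) := by
  have hx := extChartAt_mem_localDomain hp hψp
  have hchain : HasMFDerivAt (𝓡 k) 𝓘(ℝ, Euc n) (extChartAt (𝓡 n) (ψ p₀) ∘ ψ) p _ :=
    (hasMFDerivAt_extChartAt_coords hψp).comp p
      (hψ.1.contMDiffAt.mdifferentiableAt (by simp)).hasMFDerivAt
  rw [fderiv_apply_coords (h' := extChartAt (𝓡 n) (ψ p₀) ∘ ψ) hp
    ((hψ.contDiffAt_localMap hx).differentiableAt (by simp)), hchain.mfderiv]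
  · rfl
  · filter_upwards [(isOpen_extChartAt_source p₀).mem_nhds hp] with z hz
    exact localMap_extChartAt hz

theorem injective_fderiv_localMap : Function.Injective
    (fderiv ℝ (localMap (k := k) (n := n) ψ p₀) (extChartAt (𝓡 k) p₀ p)) := by
  intro u v huv
  obtain ⟨u, rfl⟩ := (isInvertible_coords hp).surjective u
  obtain ⟨v, rfl⟩ := (isInvertible_coords hp).surjective v
  rw [hψ.fderiv_localMap hp hψp, hψ.fderiv_localMap hp hψp] at huv
  rw [hψ.2 p ((isInvertible_coords hψp).injective huv)]

end Point

variable (g : ContMDiffRiemannianMetric (𝓡 n) ∞ (Euc n) (fun p : P ↦ TangentSpace (𝓡 n) p))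

theorem isMetricOn_pullbackForm (p₀ : M) :
    IsMetricOn (pullbackForm (localMetric g (ψ p₀)) (localMap (k := k) ψ p₀))
      (localDomain k n ψ p₀) := by
  refine (isMetricOn_localMetric g (ψ p₀)).pullbackForm
    (isOpen_localDomain hψ.1.continuous p₀) (hψ.contDiffOn_localMap p₀) (mapsTo_localMap ψ p₀)
    fun x hx u hu ↦ ?_
  obtain ⟨p, hp, hψp, rfl⟩ := exists_of_mem_localDomain hx
  by_contra hne
  exact (localMetric_pos g (mapsTo_localMap ψ p₀ hx)
    ((map_ne_zero_iff _ (hψ.injective_fderiv_localMap hp hψp)).2 hne)).ne' (hu u)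

section Point

variable {p₀ p : M} (hp : p ∈ (extChartAt (𝓡 k) p₀).source)
  (hψp : ψ p ∈ (extChartAt (𝓡 n) (ψ p₀)).source)
include hp hψp

theorem pullbackForm_localMap (u v : TangentSpace (𝓡 k) p) :
    pullbackForm (localMetric g (ψ p₀)) (localMap (k := k) ψ p₀) (extChartAt (𝓡 k) p₀ p)
      (coords p₀ p u) (coords p₀ p v) = inducedMetric (k := k) g ψ p u v := by
  rw [pullbackForm, pullForm_apply, hψ.fderiv_localMap hp hψp, hψ.fderiv_localMap hp hψp,
    localMap_extChartAt hp, localMetric_coords g hψp]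
  rfl

theorem ofCoords_localSecondForm_eq {p₁ : M} (hp₁ : p ∈ (extChartAt (𝓡 k) p₁).source)
    (hψp₁ : ψ p ∈ (extChartAt (𝓡 n) (ψ p₁)).source) (u v : TangentSpace (𝓡 k) p) :
    ofCoords (ψ p₁) (ψ p) (localSecondForm (localMetric g (ψ p₁)) (localMap ψ p₁)
      (extChartAt (𝓡 k) p₁ p) (coords p₁ p u) (coords p₁ p v)) =
    ofCoords (ψ p₀) (ψ p) (localSecondForm (localMetric g (ψ p₀)) (localMap ψ p₀)
      (extChartAt (𝓡 k) p₀ p) (coords p₀ p u) (coords p₀ p v)) := by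
  have hx := extChartAt_mem_localDomain hp hψp
  have hx₁ := extChartAt_mem_localDomain hp₁ hψp₁
  have hfx : localMap (k := k) (n := n) ψ p₀ (extChartAt (𝓡 k) p₀ p) =
      extChartAt (𝓡 n) (ψ p₀) (ψ p) := localMap_extChartAt hp
  have hχx : (extChartAt (𝓡 k) p₁ ∘ (extChartAt (𝓡 k) p₀).symm) (extChartAt (𝓡 k) p₀ p) =
      extChartAt (𝓡 k) p₁ p := by
    simp only [Function.comp_apply, (extChartAt (𝓡 k) p₀).left_inv hp]
  have hκx : (extChartAt (𝓡 n) (ψ p₁) ∘ (extChartAt (𝓡 n) (ψ p₀)).symm)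
      (extChartAt (𝓡 n) (ψ p₀) (ψ p)) = extChartAt (𝓡 n) (ψ p₁) (ψ p) := by
    simp only [Function.comp_apply, (extChartAt (𝓡 n) (ψ p₀)).left_inv hψp]
  have hchange := localSecondForm_coordChange (isMetricOn_localMetric g (ψ p₀))
    (hψ.isMetricOn_pullbackForm g p₀) hx (isMetricOn_localMetric g (ψ p₁))
    (hψ.isMetricOn_pullbackForm g p₁) (mapsTo_localMap ψ p₀ hx)
    (by rw [hfx, hκx]; exact (extChartAt (𝓡 n) (ψ p₁)).map_source hψp₁) (by rwa [hχx])
    (hψ.contDiffAt_localMap hx) (by rw [hχx]; exact hψ.contDiffAt_localMap hx₁)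
    (contDiffAt_transition hp hp₁) (by rw [hfx]; exact contDiffAt_transition hψp hψp₁)
    (by rw [hfx]; exact pullbackForm_transition hψp hψp₁ g)
    (localMap_comp_transition hp hψ.1.continuous hψp hp₁) (coords p₀ p u) (coords p₀ p v)
  obtain ⟨B, hB⟩ := (isInvertible_coords hψp).surjective (localSecondForm (localMetric g (ψ p₀))
    (localMap ψ p₀) (extChartAt (𝓡 k) p₀ p) (coords p₀ p u) (coords p₀ p v))
  rw [fderiv_transition hp hp₁, fderiv_transition hp hp₁, hχx, ← hB, hfx,
    fderiv_transition hψp hψp₁] at hchange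
  rw [hchange, ← hB, ofCoords_coords hψp₁, ofCoords_coords hψp]

theorem coords_secondForm (u v : TangentSpace (𝓡 k) p) :
    coords (ψ p₀) (ψ p) (secondForm g ψ p u v) =
      localSecondForm (localMetric g (ψ p₀)) (localMap (k := k) ψ p₀) (extChartAt (𝓡 k) p₀ p)
        (coords p₀ p u) (coords p₀ p v) := by
  rw [secondForm, hψ.ofCoords_localSecondForm_eq g hp hψp (mem_extChartAt_source p)
    (mem_extChartAt_source (ψ p)), coords_ofCoords hψp]

theorem coords_meanCurvatureVector :
    coords (ψ p₀) (ψ p) (meanCurvatureVector (k := k) g ψ p) =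
      (k : ℝ)⁻¹ • metricTrace (pullbackForm (localMetric g (ψ p₀)) (localMap (k := k) ψ p₀)
        (extChartAt (𝓡 k) p₀ p))
        (localSecondForm (localMetric g (ψ p₀)) (localMap (k := k) ψ p₀)
          (extChartAt (𝓡 k) p₀ p)) := by
  have hx := extChartAt_mem_localDomain hp hψp
  rw [meanCurvatureVector, map_smul]
  congr 1
  calc
    _ = metricTrace (inducedMetric (k := k) g ψ p)
        (fun u v ↦ coords (ψ p₀) (ψ p) (secondForm (k := k) g ψ p u v)) :=
      map_metricTrace (coords (ψ p₀) (ψ p)).toLinearMap _ _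
    _ = _ := by
      simp only [hψ.coords_secondForm g hp hψp]
      exact metricTrace_isometry ((hψ.isMetricOn_pullbackForm g p₀).isInvertible _ hx)
        (hψ.isInvertible_inducedMetric g p) (isInvertible_coords hp).surjective
        (fun u v ↦ (hψ.pullbackForm_localMap g hp hψp u v).symm)
        (isBilinearMap_localSecondForm _ (hψ.contDiffAt_localMap hx))

end Point

theorem contDiffOn_localAlong_meanCurvatureVector (p₀ : M) :
    ContDiffOn ℝ ∞ (localAlong ψ (meanCurvatureVector (k := k) g ψ) p₀)
      (localDomain k n ψ p₀) := by
  refine ((contDiffOn_metricTrace_localSecondForm (isMetricOn_localMetric g (ψ p₀))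
    (hψ.isMetricOn_pullbackForm g p₀) (hψ.contDiffOn_localMap p₀)
    (mapsTo_localMap ψ p₀)).const_smul (k : ℝ)⁻¹).congr fun x hx ↦ ?_
  obtain ⟨p, hp, hψp, rfl⟩ := exists_of_mem_localDomain hx
  rw [localAlong_extChartAt hp, hψ.coords_meanCurvatureVector g hp hψp]

theorem inner_secondForm (p : M) (u v w : TangentSpace (𝓡 k) p) :
    g.inner (ψ p) (secondForm g ψ p u v) (mfderiv (𝓡 k) (𝓡 n) ψ p w) = 0 := by
  have hp := mem_extChartAt_source (I := 𝓡 k) p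
  have hψp := mem_extChartAt_source (I := 𝓡 n) (ψ p)
  have hx := extChartAt_mem_localDomain hp hψp
  rw [← localMetric_coords g hψp, hψ.coords_secondForm g hp hψp, ← hψ.fderiv_localMap hp hψp,
    ← localMap_extChartAt hp]
  exact apply_localSecondForm (isMetricOn_localMetric g (ψ p)) (hψ.isMetricOn_pullbackForm g p) hx
    (mapsTo_localMap ψ p hx) (hψ.contDiffAt_localMap hx) _ _ _

theorem inner_meanCurvatureVector (p : M) (u : TangentSpace (𝓡 k) p) :
    g.inner (ψ p) (meanCurvatureVector (k := k) g ψ p) (mfderiv (𝓡 k) (𝓡 n) ψ p u) = 0 := by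
  have htrace := map_metricTrace (g.inner (ψ p) (mfderiv (𝓡 k) (𝓡 n) ψ p u)).toLinearMap
    (inducedMetric g ψ p) (secondForm (k := k) g ψ p)
  simp only [ContinuousLinearMap.coe_coe, g.symm (ψ p) (mfderiv (𝓡 k) (𝓡 n) ψ p u),
    hψ.inner_secondForm g, metricTrace_zero] at htrace
  rw [meanCurvatureVector, g.symm, map_smul, g.symm, htrace, smul_zero]

end IsSmoothImmersion

end Maps

section Functions

variable {k : ℕ} {M : Type*} [TopologicalSpace M] [ChartedSpace (Euc k) M] [IsManifold (𝓡 k) ∞ M]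

section Chart

variable {F : Type*} [NormedAddCommGroup F] [NormedSpace ℝ F] {h : M → F} {q p : M}
  (hp : p ∈ (extChartAt (𝓡 k) q).source) (hh : MDifferentiableAt (𝓡 k) 𝓘(ℝ, F) h p)
include hp hh

theorem differentiableAt_comp_extChartAt_symm :
    DifferentiableAt ℝ (h ∘ (extChartAt (𝓡 k) q).symm) (extChartAt (𝓡 k) q p) := by
  rw [← mdifferentiableAt_iff_differentiableAt]
  refine MDifferentiableAt.comp _ ?_
    ((contMDiffAt_extChartAt_symm hp).mdifferentiableAt (by simp))
  rwa [(extChartAt (𝓡 k) q).left_inv hp]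

theorem fderiv_comp_extChartAt_symm (u : TangentSpace (𝓡 k) p) :
    fderiv ℝ (h ∘ (extChartAt (𝓡 k) q).symm) (extChartAt (𝓡 k) q p) (coords q p u) =
      mfderiv (𝓡 k) 𝓘(ℝ, F) h p u := by
  refine fderiv_apply_coords hp (differentiableAt_comp_extChartAt_symm hp hh) ?_ u
  filter_upwards [(isOpen_extChartAt_source q).mem_nhds hp] with z hz
  simp only [Function.comp_apply, (extChartAt (𝓡 k) q).left_inv hz]

theorem fderiv_comp_extChartAt_symm_eq_zero_iff :
    fderiv ℝ (h ∘ (extChartAt (𝓡 k) q).symm) (extChartAt (𝓡 k) q p) = 0 ↔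
      mfderiv (𝓡 k) 𝓘(ℝ, F) h p = 0 := by
  simp only [ContinuousLinearMap.ext_iff, (isInvertible_coords hp).surjective.forall,
    fderiv_comp_extChartAt_symm hp hh]
  rfl

end Chart

theorem mfderiv_eq_zero_of_isLocalMin {h : M → ℝ} {p : M}
    (hh : MDifferentiableAt (𝓡 k) 𝓘(ℝ, ℝ) h p) (hmin : IsLocalMin h p) :
    mfderiv (𝓡 k) 𝓘(ℝ, ℝ) h p = 0 := by
  have hp := mem_extChartAt_source (I := 𝓡 k) p
  rw [← fderiv_comp_extChartAt_symm_eq_zero_iff hp hh]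
  refine IsLocalMin.fderiv_eq_zero (IsLocalMin.comp_continuous ?_
    (contMDiffAt_extChartAt_symm hp).continuousAt)
  rwa [(extChartAt (𝓡 k) p).left_inv hp]

theorem isLocallyConstant_of_mfderiv_eq_zero {F : Type*} [NormedAddCommGroup F] [NormedSpace ℝ F]
    {h : M → F} (hh : MDifferentiable (𝓡 k) 𝓘(ℝ, F) h)
    (hzero : ∀ p, mfderiv (𝓡 k) 𝓘(ℝ, F) h p = 0) : IsLocallyConstant h := by
  rw [IsLocallyConstant.iff_eventually_eq]
  intro p
  have hp := mem_extChartAt_source (I := 𝓡 k) p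
  have hdiff : DifferentiableOn ℝ (h ∘ (extChartAt (𝓡 k) p).symm) (extChartAt (𝓡 k) p).target := by
    intro y hy
    have hd := differentiableAt_comp_extChartAt_symm ((extChartAt (𝓡 k) p).map_target hy) (hh _)
    rw [(extChartAt (𝓡 k) p).right_inv hy] at hd
    exact hd.differentiableWithinAt
  have hfderiv : (extChartAt (𝓡 k) p).target.EqOn
      (fderiv ℝ (h ∘ (extChartAt (𝓡 k) p).symm)) 0 := by
    intro y hy
    have hd := (fderiv_comp_extChartAt_symm_eq_zero_iff ((extChartAt (𝓡 k) p).map_target hy)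
      (hh _)).2 (hzero _)
    rwa [(extChartAt (𝓡 k) p).right_inv hy] at hd
  have hopen := (isOpen_extChartAt_target p).isOpen_inter_preimage_of_fderiv_eq_zero hdiff hfderiv
    {h p}
  have hmem : extChartAt (𝓡 k) p p ∈ (extChartAt (𝓡 k) p).target ∩
      (h ∘ (extChartAt (𝓡 k) p).symm) ⁻¹' {h p} :=
    ⟨mem_extChartAt_target p, congrArg h ((extChartAt (𝓡 k) p).left_inv hp)⟩
  filter_upwards [(isOpen_extChartAt_source p).mem_nhds hp,
    (continuousAt_extChartAt p).preimage_mem_nhds (hopen.mem_nhds hmem)] with z hz hz'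
  simpa only [Set.mem_preimage, Set.mem_singleton_iff, Function.comp_apply,
    (extChartAt (𝓡 k) p).left_inv hz] using hz'.2

end Functions

section EtaEinstein

variable {n : ℕ} {P : Type*} [TopologicalSpace P] [ChartedSpace (Euc n) P]
  [IsManifold (𝓡 n) ∞ P] {S : SasakianStructure n P} {a b c : ℝ}

/-- The Sasakian manifold is `η`-Einstein: its Ricci tensor is `a g + b η ⊗ η` for constants
`a` and `b`. As in `SasakianStructure.IsSpaceForm`, the equation is written in the charts. -/
def SasakianStructure.IsEtaEinstein (S : SasakianStructure n P) (a b : ℝ) : Prop :=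
  ∀ q : P, ∀ y ∈ (extChartAt (𝓡 n) q).target, ∀ u v : Euc n,
    let g := localMetric S.metric q y
    let ξ := localField S.xi q y
    ricci (localMetric S.metric q) y u v = a * g u v + b * (g ξ u * g ξ v)

namespace SasakianStructure

theorem IsSpaceForm.isEtaEinstein (hc : S.IsSpaceForm c) :
    S.IsEtaEinstein ((c - 1) / 2 + (n - 1) * (c + 3) / 4) (-(n + 1) * (c - 1) / 4) :=
  fun q y hy ↦ (S.isSasakianOn q).ricci_eq hy (hc q y hy)

namespace IsEtaEinstein

variable (hE : S.IsEtaEinstein a b) (hRic : RicciIsMetric S.metric) {q : P} {y : Euc n}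
  (hy : y ∈ (extChartAt (𝓡 n) q).target)
include hE hRic hy

theorem ne_zero {u : Euc n} (hu : u ≠ 0)
    (hξu : localMetric S.metric q y (localField S.xi q y) u = 0) : a ≠ 0 := by
  rintro rfl
  refine hu (hRic q y hy u fun v ↦ ?_)
  rw [hE q y hy, hξu, zero_mul, zero_mul, mul_zero, add_zero]

theorem add_ne_zero : a + b ≠ 0 := by
  intro hab
  have hS := S.isSasakianOn q
  refine hS.xi_ne_zero hy (hRic q y hy _ fun v ↦ ?_)
  rw [hE q y hy, hS.eta_xi y hy, one_mul, ← add_mul, hab, zero_mul]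

theorem isEtaDeformation {u : Euc n} (hu : u ≠ 0)
    (hξu : localMetric S.metric q y (localField S.xi q y) u = 0) :
    IsEtaDeformation (localMetric S.metric q) (localField S.xi q) a b
      (ricci (localMetric S.metric q)) (extChartAt (𝓡 n) q).target :=
  ⟨hE.ne_zero hRic hy hu hξu, hE.add_ne_zero hRic hy, hE q⟩

end IsEtaEinstein

end SasakianStructure

end EtaEinstein

section Submanifold

variable {k n : ℕ} {P : Type*} [TopologicalSpace P] [ChartedSpace (Euc n) P]
  [IsManifold (𝓡 n) ∞ P] {M : Type*} [TopologicalSpace M] [ChartedSpace (Euc k) M]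

theorem meanCurvature_sq
    (g : ContMDiffRiemannianMetric (𝓡 n) ∞ (Euc n) (fun p : P ↦ TangentSpace (𝓡 n) p))
    (ψ : M → P) (p : M) :
    meanCurvature (k := k) g ψ p ^ 2 =
      g.inner (ψ p) (meanCurvatureVector (k := k) g ψ p) (meanCurvatureVector (k := k) g ψ p) := by
  rw [meanCurvature, Real.sq_sqrt]
  by_cases hH : meanCurvatureVector (k := k) g ψ p = 0
  · rw [hH, map_zero]
  · exact (g.pos _ _ hH).le

theorem isLocalMin_meanCurvature_of_meanCurvatureVector_eq_zero
    {g : ContMDiffRiemannianMetric (𝓡 n) ∞ (Euc n) (fun p : P ↦ TangentSpace (𝓡 n) p)}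
    {ψ : M → P} {p : M} (hH : meanCurvatureVector (k := k) g ψ p = 0) :
    IsLocalMin (meanCurvature (k := k) g ψ) p := by
  refine Eventually.of_forall fun q ↦ ?_
  rw [meanCurvature, hH, map_zero, Real.sqrt_zero]
  exact Real.sqrt_nonneg _

theorem surfaceGradient_eq_zero_of_mfderiv_eq_zero
    {g : ContMDiffRiemannianMetric (𝓡 n) ∞ (Euc n) (fun p : P ↦ TangentSpace (𝓡 n) p)}
    {ψ : M → P} {h : M → ℝ} {p : M} (hh : mfderiv (𝓡 k) 𝓘(ℝ, ℝ) h p = 0) :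
    surfaceGradient (k := k) g ψ h p = 0 :=
  (congrArg (inducedMetric g ψ p).inverse hh).trans (map_zero (inducedMetric g ψ p).inverse)

variable {S : SasakianStructure n P} {ψ : M → P}

theorem XiTangent.inner_xi_eq_zero (hξ : XiTangent (k := k) ψ S) {p : M}
    {w : TangentSpace (𝓡 n) (ψ p)}
    (hw : ∀ u, S.metric.inner (ψ p) w (mfderiv (𝓡 k) (𝓡 n) ψ p u) = 0) :
    S.metric.inner (ψ p) (S.xi (ψ p)) w = 0 := by
  obtain ⟨u, hu⟩ := hξ p
  rw [← hu, S.metric.symm, hw u]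

section UnitNormal

variable {N : ∀ p : M, TangentSpace (𝓡 n) (ψ p)} (hξ : XiTangent (k := k) ψ S)
  (hN : IsUnitNormal (k := k) S.metric ψ N)
include hξ hN

theorem inner_fieldV_phi (p : M) (w : TangentSpace (𝓡 n) (ψ p)) :
    S.metric.inner (ψ p) (fieldV S ψ N p) (S.phi (ψ p) w) = -S.metric.inner (ψ p) (N p) w := by
  rw [fieldV, map_neg, neg_apply, S.metric_phi, hξ.inner_xi_eq_zero (hN p).2, zero_mul, sub_zero]

theorem fieldV_ne_zero (p : M) : fieldV S ψ N p ≠ 0 := by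
  intro h
  have hnorm := inner_fieldV_phi hξ hN p (N p)
  rw [h, (hN p).1] at hnorm
  simp at hnorm

end UnitNormal

namespace IsSmoothImmersion

variable (hψ : IsSmoothImmersion (k := k) (n := n) ψ)
include hψ

theorem inner_mfderiv_surfaceGradient
    (g : ContMDiffRiemannianMetric (𝓡 n) ∞ (Euc n) (fun p : P ↦ TangentSpace (𝓡 n) p))
    (h : M → ℝ) (p : M) (w : TangentSpace (𝓡 k) p) :
    g.inner (ψ p) (mfderiv (𝓡 k) (𝓡 n) ψ p (surfaceGradient (k := k) g ψ h p))
      (mfderiv (𝓡 k) (𝓡 n) ψ p w) = mfderiv (𝓡 k) 𝓘(ℝ, ℝ) h p w :=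
  congrArg (fun L ↦ L w) ((hψ.isInvertible_inducedMetric g p).self_apply_inverse _)

variable [IsManifold (𝓡 k) ∞ M]

theorem isContactNormalField_meanCurvatureVector (hξ : XiTangent (k := k) ψ S) (p₀ : M) :
    IsContactNormalField (localMetric S.metric (ψ p₀)) (localField S.xi (ψ p₀))
      (extChartAt (𝓡 n) (ψ p₀)).target (localMap (k := k) ψ p₀)
      (localAlong ψ (meanCurvatureVector (k := k) S.metric ψ) p₀) (localDomain k n ψ p₀) where
  isOpen := isOpen_localDomain hψ.1.continuous p₀
  mapsTo := mapsTo_localMap ψ p₀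
  contDiffOn_map := hψ.contDiffOn_localMap p₀
  contDiffOn := hψ.contDiffOn_localAlong_meanCurvatureVector S.metric p₀
  normal x hx u := by
    obtain ⟨p, hp, hψp, rfl⟩ := exists_of_mem_localDomain hx
    obtain ⟨u, rfl⟩ := (isInvertible_coords hp).surjective u
    rw [hψ.fderiv_localMap hp hψp, localMap_extChartAt hp, localAlong_extChartAt hp,
      localMetric_coords _ hψp, hψ.inner_meanCurvatureVector]
  eta x hx := by
    obtain ⟨p, hp, hψp, rfl⟩ := exists_of_mem_localDomain hx
    rw [localMap_extChartAt hp, localAlong_extChartAt hp, localField_extChartAt hψp,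
      localMetric_coords _ hψp, hξ.inner_xi_eq_zero (hψ.inner_meanCurvatureVector S.metric p)]

theorem exists_fderiv_localMap_eq_xi (hξ : XiTangent (k := k) ψ S) {p₀ : M} {x : Euc k}
    (hx : x ∈ localDomain k n ψ p₀) :
    ∃ w, fderiv ℝ (localMap (k := k) ψ p₀) x w = localField S.xi (ψ p₀) (localMap ψ p₀ x) := by
  obtain ⟨p, hp, hψp, rfl⟩ := exists_of_mem_localDomain hx
  obtain ⟨u, hu⟩ := hξ p
  exact ⟨coords p₀ p u, by
    rw [hψ.fderiv_localMap hp hψp, hu, localMap_extChartAt hp, localField_extChartAt hψp]⟩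

theorem isMetricOn_pullbackForm_of_isEtaDeformation (hξ : XiTangent (k := k) ψ S) {p₀ : M}
    {a b : ℝ} {Gh : FormField n} (hD : IsEtaDeformation (localMetric S.metric (ψ p₀))
      (localField S.xi (ψ p₀)) a b Gh (extChartAt (𝓡 n) (ψ p₀)).target) :
    IsMetricOn (pullbackForm Gh (localMap (k := k) ψ p₀)) (localDomain k n ψ p₀) := by
  refine hD.isMetricOn_pullbackForm (S.isSasakianOn _) (isOpen_localDomain hψ.1.continuous p₀)
    (hψ.contDiffOn_localMap p₀) (mapsTo_localMap ψ p₀) (fun x hx ↦ ?_)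
    fun x hx ↦ hψ.exists_fderiv_localMap_eq_xi hξ hx
  obtain ⟨p, hp, hψp, rfl⟩ := exists_of_mem_localDomain hx
  exact hψ.injective_fderiv_localMap hp hψp

end IsSmoothImmersion

theorem localMetric_localAlong_meanCurvatureVector
    (g : ContMDiffRiemannianMetric (𝓡 n) ∞ (Euc n) (fun p : P ↦ TangentSpace (𝓡 n) p))
    {p₀ : M} {x : Euc k} (hx : x ∈ localDomain k n ψ p₀) :
    localMetric g (ψ p₀) (localMap ψ p₀ x)
        (localAlong ψ (meanCurvatureVector (k := k) g ψ) p₀ x)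
        (localAlong ψ (meanCurvatureVector (k := k) g ψ) p₀ x) =
      (meanCurvature (k := k) g ψ ∘ (extChartAt (𝓡 k) p₀).symm) x ^ 2 := by
  obtain ⟨p, hp, hψp, rfl⟩ := exists_of_mem_localDomain hx
  rw [localMap_extChartAt hp, localAlong_extChartAt hp, localMetric_coords _ hψp,
    Function.comp_apply, (extChartAt (𝓡 k) p₀).left_inv hp, meanCurvature_sq]

theorem fderiv_localMetric_localAlong_meanCurvatureVector [IsManifold (𝓡 k) ∞ M]
    (hψ : Continuous ψ)
    (g : ContMDiffRiemannianMetric (𝓡 n) ∞ (Euc n) (fun p : P ↦ TangentSpace (𝓡 n) p)) {p : M}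
    (hdiff : MDifferentiableAt (𝓡 k) 𝓘(ℝ, ℝ) (meanCurvature (k := k) g ψ) p)
    (u : TangentSpace (𝓡 k) p) :
    fderiv ℝ (fun x ↦ localMetric g (ψ p) (localMap ψ p x)
        (localAlong ψ (meanCurvatureVector (k := k) g ψ) p x)
        (localAlong ψ (meanCurvatureVector (k := k) g ψ) p x))
        (extChartAt (𝓡 k) p p) (coords p p u) =
      (2 * meanCurvature (k := k) g ψ p) •
        mfderiv (𝓡 k) 𝓘(ℝ, ℝ) (meanCurvature (k := k) g ψ) p u := by
  have hp := mem_extChartAt_source (I := 𝓡 k) p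
  have hx := extChartAt_mem_localDomain hp (mem_extChartAt_source (I := 𝓡 n) (ψ p))
  have hsq := eventually_of_mem ((isOpen_localDomain hψ p).mem_nhds hx) fun x hx ↦
    localMetric_localAlong_meanCurvatureVector g hx
  rw [EventuallyEq.fderiv_eq hsq,
    ((differentiableAt_comp_extChartAt_symm hp hdiff).hasFDerivAt.pow 2).fderiv, smul_apply,
    fderiv_comp_extChartAt_symm hp hdiff]
  simp only [Function.comp_apply, (extChartAt (𝓡 k) p).left_inv hp, Nat.add_one_sub_one, pow_one,
    nsmul_eq_mul, Nat.cast_ofNat]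
  rfl

end Submanifold

section Hypersurface

variable {k : ℕ} {P : Type*} [TopologicalSpace P] [ChartedSpace (Euc (k + 1)) P]
  [IsManifold (𝓡 (k + 1)) ∞ P] {M : Type*} [TopologicalSpace M] [ChartedSpace (Euc k) M]
  {S : SasakianStructure (k + 1) P} {a b : ℝ} {ψ : M → P}
  (hψ : IsSmoothImmersion (k := k) (n := k + 1) ψ)
include hψ

theorem IsUnitNormal.inner_ne_zero
    {g : ContMDiffRiemannianMetric (𝓡 (k + 1)) ∞ (Euc (k + 1))
      (fun p : P ↦ TangentSpace (𝓡 (k + 1)) p)}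
    {N : ∀ p : M, TangentSpace (𝓡 (k + 1)) (ψ p)} (hN : IsUnitNormal (k := k) g ψ N) {p : M}
    {w : TangentSpace (𝓡 (k + 1)) (ψ p)} (hw : w ≠ 0)
    (hwn : ∀ u, g.inner (ψ p) w (mfderiv (𝓡 k) (𝓡 (k + 1)) ψ p u) = 0) :
    g.inner (ψ p) (N p) w ≠ 0 := by
  intro hNw
  have hdim : Module.finrank ℝ (Euc k) + 1 = Module.finrank ℝ (Euc (k + 1)) := by simp
  have hl : (g.inner (ψ p) w).toLinearMap ≠ 0 := fun h ↦
    (g.pos _ _ hw).ne' (LinearMap.congr_fun h w)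
  have hrange := range_eq_ker_of_finrank_add_one_eq
    (L := (mfderiv (𝓡 k) (𝓡 (k + 1)) ψ p).toLinearMap) hdim (hψ.2 p) hl hwn
  obtain ⟨u, hu⟩ := hrange.ge (show N p ∈ _ from (g.symm _ _ _).trans hNw)
  refine one_ne_zero (α := ℝ) ?_
  rw [← (hN p).1, ← (hN p).2 u]
  exact congrArg _ hu.symm

variable [IsManifold (𝓡 k) ∞ M]

theorem IsRicciBiharmonic.exists_mfderiv_meanCurvature_eq_zero
    (hbi : IsRicciBiharmonic (k := k) S.metric ψ) (hE : S.IsEtaEinstein a b)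
    (hRic : RicciIsMetric S.metric) (hξ : XiTangent (k := k) ψ S) {p : M}
    (hdiff : MDifferentiableAt (𝓡 k) 𝓘(ℝ, ℝ) (meanCurvature (k := k) S.metric ψ) p)
    (hH : meanCurvatureVector (k := k) S.metric ψ p ≠ 0) :
    ∃ w : TangentSpace (𝓡 k) p, mfderiv (𝓡 k) (𝓡 (k + 1)) ψ p w =
      S.phi (ψ p) (meanCurvatureVector (k := k) S.metric ψ p) ∧
      mfderiv (𝓡 k) 𝓘(ℝ, ℝ) (meanCurvature (k := k) S.metric ψ) p w = 0 := by
  have hp := mem_extChartAt_source (I := 𝓡 k) p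
  have hψp := mem_extChartAt_source (I := 𝓡 (k + 1)) (ψ p)
  have hx := extChartAt_mem_localDomain hp hψp
  have hfield := hψ.isContactNormalField_meanCurvatureVector hξ p
  have hsx : localAlong ψ (meanCurvatureVector (k := k) S.metric ψ) p (extChartAt (𝓡 k) p p)
      ≠ 0 := by
    rw [localAlong_extChartAt hp]
    exact (map_ne_zero_iff _ (isInvertible_coords hψp).injective).2 hH
  have hD := hE.isEtaDeformation hRic (hfield.mapsTo hx) hsx (hfield.eta _ hx)
  have hbitension := congrArg (coords (ψ p) (ψ p)) (hbi p)
  rw [ricciBitension, coords_ofCoords hψp, map_zero] at hbitension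
  obtain ⟨w, hw, hnormSq⟩ := hfield.exists_fderiv_normSq_eq_zero hx (S.isSasakianOn _) hD
    (hψ.isMetricOn_pullbackForm_of_isEtaDeformation hξ hD) rfl hsx hbitension
  obtain ⟨w, rfl⟩ := (isInvertible_coords hp).surjective w
  refine ⟨w, (isInvertible_coords hψp).injective ?_, ?_⟩
  · rw [← hψ.fderiv_localMap hp hψp, hw, localMap_extChartAt hp, localAlong_extChartAt hp,
      localEndo_coords hψp]
  · have hpos : 0 < meanCurvature (k := k) S.metric ψ p := Real.sqrt_pos.2 (S.metric.pos _ _ hH)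
    rw [fderiv_localMetric_localAlong_meanCurvatureVector hψ.1.continuous S.metric hdiff]
      at hnormSq
    exact (smul_eq_zero.1 hnormSq).resolve_left (by positivity)

end Hypersurface

end RicciBiharmonic

end

theorem mainTheorem6_general {k : ℕ}
    {P : Type*} [TopologicalSpace P] [ChartedSpace (EuclideanSpace ℝ (Fin (k + 1))) P]
    [IsManifold (𝓡 (k + 1)) ∞ P]
    {M : Type*} [TopologicalSpace M] [ChartedSpace (EuclideanSpace ℝ (Fin k)) M]
    [IsManifold (𝓡 k) ∞ M] [PreconnectedSpace M]
    {S : SasakianStructure (k + 1) P} {a b : ℝ} (hE : S.IsEtaEinstein a b)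
    (hRic : RicciIsMetric S.metric)
    {ψ : M → P} (hψ : IsSmoothImmersion (k := k) (n := k + 1) ψ)
    (hξ : XiTangent (k := k) ψ S)
    {N : ∀ p : M, TangentSpace (𝓡 (k + 1)) (ψ p)}
    (hN : IsUnitNormal (k := k) S.metric ψ N)
    (hbi : IsRicciBiharmonic (k := k) S.metric ψ)
    {β : M → ℝ}
    (hdiff : MDifferentiable (𝓡 k) 𝓘(ℝ, ℝ) (meanCurvature (k := k) S.metric ψ))
    (hgrad : ∀ p : M, mfderiv (𝓡 k) (𝓡 (k + 1)) ψ p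
      (surfaceGradient (k := k) S.metric ψ (meanCurvature (k := k) S.metric ψ) p) =
        β p • fieldV S ψ N p) :
    (∀ p : M, β p = 0) ∧
      ∃ a : ℝ, ∀ p : M, meanCurvature (k := k) S.metric ψ p = a := by
  have hmfderiv (p : M) (w : TangentSpace (𝓡 k) p) :
      mfderiv (𝓡 k) 𝓘(ℝ, ℝ) (meanCurvature (k := k) S.metric ψ) p w =
        β p • S.metric.inner (ψ p) (fieldV S ψ N p) (mfderiv (𝓡 k) (𝓡 (k + 1)) ψ p w) := by
    rw [← hψ.inner_mfderiv_surfaceGradient S.metric, hgrad, map_smul, smul_apply]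
  have hβ (p : M) : β p = 0 := by
    by_cases hH : meanCurvatureVector (k := k) S.metric ψ p = 0
    · have hmin := mfderiv_eq_zero_of_isLocalMin (hdiff p)
        (isLocalMin_meanCurvature_of_meanCurvatureVector_eq_zero hH)
      have hV := hgrad p
      rw [surfaceGradient_eq_zero_of_mfderiv_eq_zero hmin, map_zero] at hV
      exact (smul_eq_zero.1 hV.symm).resolve_right (fieldV_ne_zero hξ hN p)
    · obtain ⟨w, hw, hdw⟩ := hbi.exists_mfderiv_meanCurvature_eq_zero hψ hE hRic hξ (hdiff p) hH
      rw [hmfderiv, hw, inner_fieldV_phi hξ hN] at hdw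
      exact (smul_eq_zero.1 hdw).resolve_right
        (neg_ne_zero.2 (hN.inner_ne_zero hψ hH (hψ.inner_meanCurvatureVector S.metric p)))
  have hconst : IsLocallyConstant (meanCurvature (k := k) S.metric ψ) :=
    isLocallyConstant_of_mfderiv_eq_zero hdiff fun p ↦ by
      ext w
      rw [hmfderiv, hβ, zero_smul]
      rfl
  exact ⟨hβ, hconst.exists_eq_const.imp fun _ h ↦ congrFun h⟩

theorem mainTheorem6 {m : ℕ}
    {P : Type*} [TopologicalSpace P] [ChartedSpace (EuclideanSpace ℝ (Fin (2 * m + 1))) P]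
    [IsManifold (𝓡 (2 * m + 1)) ∞ P]
    {M : Type*} [TopologicalSpace M] [ChartedSpace (EuclideanSpace ℝ (Fin (2 * m))) M]
    [IsManifold (𝓡 (2 * m)) ∞ M] [PreconnectedSpace M]
    (S : SasakianStructure (2 * m + 1) P) (c : ℝ) (hc : S.IsSpaceForm c)
    (hRic : RicciIsMetric S.metric)
    (ψ : M → P) (hψ : IsSmoothImmersion (k := 2 * m) (n := 2 * m + 1) ψ)
    (hξ : XiTangent (k := 2 * m) ψ S)
    (N : ∀ p : M, TangentSpace (𝓡 (2 * m + 1)) (ψ p))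
    (hN : IsUnitNormal (k := 2 * m) S.metric ψ N)
    (hHopf : IsPseudoHopf (k := 2 * m) S ψ N)
    (hbi : IsRicciBiharmonic (k := 2 * m) S.metric ψ)
    (β : M → ℝ)
    (hdiff : MDifferentiable (𝓡 (2 * m)) 𝓘(ℝ, ℝ) (meanCurvature (k := 2 * m) S.metric ψ))
    (hgrad : ∀ p : M, mfderiv (𝓡 (2 * m)) (𝓡 (2 * m + 1)) ψ p
      (surfaceGradient (k := 2 * m) S.metric ψ (meanCurvature (k := 2 * m) S.metric ψ) p) =
        β p • fieldV S ψ N p) :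
    (∀ p : M, β p = 0) ∧
      ∃ a : ℝ, ∀ p : M, meanCurvature (k := 2 * m) S.metric ψ p = a := by
  exact mainTheorem6_general hc.isEtaEinstein hRic hψ hξ hN hbi hdiff hgrad
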